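/- \textbf{Setting.} Let $\mathcal S,\mathcal X,\mathcal Y,\widehat{\mathcal S}$ be finite nonempty alphabets, $P_S$ a probability distribution on $\mathcal S$, $P_{Y|X}$ a channel from $\mathcal X$ to $\mathcal Y$, $d:\mathcal S\times\widehat{\mathcal S}\to[0,+\infty]$ a distortion function, $\mathbf d\in[0,\infty)$, and $\kappa(s,x,y,\hat s)=\mathbb I\{d(s,\hat s)>\mathbf d\}$. All logarithms are natural. \textbf{The programs.} $\mathrm{OPT}(\mathrm{SC})$ is the infimum of $\sum\kappa\,Q$ over $Q=P_S\,Q_{X|S}\,P_{Y|X}\,Q_{\widehat S|Y}$ with $Q_{X|S},Q_{\widehat S|Y}$ conditional distributions (randomized codes). $\mathrm{OPT}(\mathrm{LP})$ is the infimum of $\sum\kappa(s,x,y,\hat s)P_S(s)P_{Y|X}(y|x)W(s,x,y,\hat s)$ over nonnegative $(Q_{X|S},Q_{\widehat S|Y},W)$ with $\sum_xQ_{X|S}(x|s)=1$, $\sum_{\hat s}Q_{\widehat S|Y}(\hat s|y)=1$, $\sum_xW(s,x,y,\hat s)=Q_{\widehat S|Y}(\hat s|y)$, $\sum_{\hat s}W(s,x,y,\hat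 s)=Q_{X|S}(x|s)$ and $Q_{X|S}(x|s)+Q_{\widehat S|Y}(\hat s|y)-W(s,x,y,\hat s)\le1$ for all $s,x,y,\hat s$. $\mathrm{OPT}(\mathrm{DP})$ is the supremum of $\sum_s\gamma^a(s)+\sum_y\gamma^b(y)-\sum\mu(s,x,y,\hat s)$ over real functions $\gamma^a(s),\gamma^b(y),\lambda^a(s,\hat s,y),\lambda^b(x,s,y)$ and $\mu(s,x,y,\hat s)\ge0$ such that, for all $s,x,y,\hat s$, \begin{align*} \gamma^a(s)-\sum_{y}\lambda^b(x,s,y)-\sum_{\hat s,y}\mu(s,x,y,\hat s)&\le0,\\ \gamma^b(y)-\sum_{s}\lambda^a(s,\hat s,y)-\sum_{x,s}\mu(s,x,y,\hat s)&\le0,\\ \lambda^a(s,\hat s,y)+\lambda^b(x,s,y)+\mu(s,x,y,\hat s)&\le\kappa(s,x,y,\hat s)P_S(s)P_{Y|X}(y|x). \end{align*} \textbf{Tilted information.} Let $R_S(D)=\inf\{I(S;\widehat S):P_{\widehat S|S},\ \mathbb E[d(S,\widehat S)]\le D\}$ ($+\infty$ if there is no such $P_{\widehat S|S}$) and $\mathbf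 d_{\min}=\inf\{D:R_S(D)<\infty\}$. Assume one of the following. (a) $\mathbf d>\mathbf d_{\min}$, the infimum in $R_S(\mathbf d)$ is attained by $P_{\widehat S^*|S}$, and $R_S$ is differentiable at $\mathbf d$. With $\lambda^*=-R_S'(\mathbf d)$ and $\widehat S^*$ distributed according to $P_{\widehat S^*}=\sum_sP_S(s)P_{\widehat S^*|S}(\cdot|s)$, put $$j_S(s,\mathbf d)=\log\frac1{\mathbb E[\exp(\lambda^*\mathbf d-\lambda^*d(s,\widehat S^*))]},$$ where the exponential is read as $0$ if $d(s,\widehat S^*)=\infty$. (b) $\mathbf d=0$ and for every $\hat s$ there is at most one $s$ with $P_S(s)>0$ and $d(s,\hat s)=0$. Put $j_S(s,0)=\log\frac1{P_S(s)}$. (Values of $j_S$ at letters with $P_S(s)=0$ are immaterial; any real value may be used.) \textbf{Auxiliary variables.} For a positive integer $T$, let $V$ take values in $\{1,\dots,T\}$ and be given by conditional distributions $P_{V|X}$, $P_{Y|X,V}$ with $P_{Y|X}(y|x)=\sum_{t=1}^TP_{Y|X,V}(y|x,t)P_{V|X}(t|x)$, and let $P_{\bar Y|V=t}$, $t=1,\dots,T$,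 be arbitrary distributions on $\mathcal Y$. Put $i_{X;\bar Y|V}(x;y|t)=\log\frac{P_{Y|X,V}(y|x,t)}{P_{\bar Y|V}(y|t)}\in[-\infty,\infty]$. For $\gamma\in\mathbb R$ let \begin{align*} p_\gamma(s,x)&=\mathbb P[j_S(s,\mathbf d)-i_{X;\bar Y|V}(x;Y|V)\ge\gamma]\quad\text{under }P_{V|X=x}P_{Y|X=x,V},\\ e_\gamma(s,x)&=\exp(j_S(s,\mathbf d)-\gamma)\sum_{y\in\mathcal Y}\sum_{t=1}^TP_{V|X}(t|x)P_{\bar Y|V}(y|t)\,\mathbb I\{j_S(s,\mathbf d)-i_{X;\bar Y|V}(x;y|t)<\gamma\},\\ K&=\sum_sP_S(s)\inf_xp_\gamma(s,x)-T\exp(-\gamma),\\ J&=\sum_sP_S(s)\inf_x\{p_\gamma(s,x)+e_\gamma(s,x)\}-T\exp(-\gamma). \end{align*} \textbf{Theorem.} (1) For all $\gamma\in\mathbb R$, $T\geq 1$, $V$, $\bar Y$, the point $\mu\equiv0$, \begin{align*} \lambda^b(x,s,y)&=P_S(s)\sum_{t=1}^T\Bigl[P_{Y|X,V}(y|x,t)P_{V|X}(t|x)\,\mathbb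 I\{P_{Y|X,V}(y|x,t)\le P_{\bar Y|V}(y|t)e^{j_S(s,\mathbf d)-\gamma}\}\\ &\qquad+P_{\bar Y|V}(y|t)e^{j_S(s,\mathbf d)-\gamma}P_{V|X}(t|x)\,\mathbb I\{P_{Y|X,V}(y|x,t)>P_{\bar Y|V}(y|t)e^{j_S(s,\mathbf d)-\gamma}\}\Bigr],\\ \lambda^a(s,\hat s,y)&=-P_S(s)e^{j_S(s,\mathbf d)-\gamma}\,\mathbb I\{d(s,\hat s)\le\mathbf d\}\sum_{t=1}^TP_{\bar Y|V}(y|t),\\ \gamma^a(s)&=\inf_x\sum_y\lambda^b(x,s,y),\qquad\gamma^b(y)=-e^{-\gamma}\sum_{t=1}^TP_{\bar Y|V}(y|t) \end{align*} is feasible for $\mathrm{DP}$ and has objective value $J$; moreover $e_\gamma\ge0$, so that $J\ge K$. (2) For every code, deterministic or randomized, $$\mathbb P[d(S,\widehat S)>\mathbf d]\ \ge\ \mathrm{OPT}(\mathrm{SC})\ \ge\ \mathrm{OPT}(\mathrm{LP})=\mathrm{OPT}(\mathrm{DP})\ \ge\ \sup_{\gamma\in\mathbb R,\,T}\ \sup_{\bar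 Y,V}J\ \ge\ \sup_{\gamma>0,\,T}\ \sup_{\bar Y,V}K,$$ the last expression being the generalized Kostina--Verd\'u converse. (3) There is a feasible point of $\mathrm{DP}$ with objective value at least $\sup_{\gamma,T}\sup_{\bar Y,V}J$; hence its value is at least the generalized Kostina--Verd\'u converse. -/

import Mathlib

open scoped ENNReal

noncomputable section

namespace JSCC

/-! Finite alphabets `S` (source), `X` (channel input), `Y` (channel output), `Sh` (destination).
A distribution on `α` is an element of `stdSimplex ℝ α`; a conditional distribution from `α` to `β`
is a map `k : α → β → ℝ` all of whose values `k a` are distributions on `β`. -/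

/-- `k a b` is the conditional probability of `b` given `a`. -/
def IsKernel {α β : Type*} [Fintype β] (k : α → β → ℝ) : Prop :=
  ∀ a, k a ∈ stdSimplex ℝ β

open Classical in
/-- The indicator of a proposition, as a real number. -/
def ind (p : Prop) : ℝ := if p then 1 else 0

/-! ### The problem SC, its linear programming relaxation LP, and the dual program DP -/

section Programs

variable {S X Y Sh : Type*}

/-- The variables `(Q, Q_{X|S}, Q_{Ŝ|Y})` of problem SC (over randomized codes). -/
structure SCPoint (S X Y Sh : Type*) where
  Q : S → X → Y → Sh → ℝ
  QXS : S → X → ℝ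
  QShY : Y → Sh → ℝ

/-- The variables `(Q_{X|S}, Q_{Ŝ|Y}, W)` of problem LP. -/
structure LPPoint (S X Y Sh : Type*) where
  QXS : S → X → ℝ
  QShY : Y → Sh → ℝ
  W : S → X → Y → Sh → ℝ

/-- The variables `(γᵃ, γᵇ, λᵃ, λᵇ, μ)` of problem DP. -/
structure DPPoint (S X Y Sh : Type*) where
  gammaA : S → ℝ
  gammaB : Y → ℝ
  lamA : S → Sh → Y → ℝ
  lamB : X → S → Y → ℝ
  mu : S → X → Y → Sh → ℝ

variable [Fintype S] [Fintype X] [Fintype Y] [Fintype Sh]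

/-- Feasibility for SC: `Q = P_S Q_{X|S} P_{Y|X} Q_{Ŝ|Y}` with `Q_{X|S}`, `Q_{Ŝ|Y}` conditional
distributions. -/
def SCPoint.Feasible (PS : S → ℝ) (PYX : X → Y → ℝ) (p : SCPoint S X Y Sh) : Prop :=
  (∀ s x y sh, p.Q s x y sh = PS s * p.QXS s x * PYX x y * p.QShY y sh) ∧
  IsKernel p.QXS ∧ IsKernel p.QShY

/-- The objective of SC: the expected loss. -/
def SCPoint.objective (κ : S → X → Y → Sh → ℝ) (p : SCPoint S X Y Sh) : ℝ :=
  ∑ s, ∑ x, ∑ y, ∑ sh, κ s x y sh * p.Q s x y sh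

/-- `OPT(SC)`. -/
def optSC (PS : S → ℝ) (PYX : X → Y → ℝ) (κ : S → X → Y → Sh → ℝ) : EReal :=
  ⨅ (p : SCPoint S X Y Sh) (_ : p.Feasible PS PYX), ((p.objective κ : ℝ) : EReal)

/-- Feasibility for LP. -/
structure LPPoint.Feasible (p : LPPoint S X Y Sh) : Prop where
  sum_QXS : ∀ s, ∑ x, p.QXS s x = 1
  sum_QShY : ∀ y, ∑ sh, p.QShY y sh = 1
  sum_W_x : ∀ s sh y, ∑ x, p.W s x y sh - p.QShY y sh = 0
  sum_W_sh : ∀ x s y, ∑ sh, p.W s x y sh - p.QXS s x = 0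
  mccormick : ∀ s x y sh, p.QXS s x + p.QShY y sh - p.W s x y sh ≤ 1
  QXS_nonneg : ∀ s x, 0 ≤ p.QXS s x
  QShY_nonneg : ∀ y sh, 0 ≤ p.QShY y sh
  W_nonneg : ∀ s x y sh, 0 ≤ p.W s x y sh

/-- The objective of LP. -/
def LPPoint.objective (PS : S → ℝ) (PYX : X → Y → ℝ) (κ : S → X → Y → Sh → ℝ)
    (p : LPPoint S X Y Sh) : ℝ :=
  ∑ s, ∑ x, ∑ y, ∑ sh, κ s x y sh * PS s * PYX x y * p.W s x y sh

/-- `OPT(LP)`. -/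
def optLP (PS : S → ℝ) (PYX : X → Y → ℝ) (κ : S → X → Y → Sh → ℝ) : EReal :=
  ⨅ (p : LPPoint S X Y Sh) (_ : p.Feasible), ((p.objective PS PYX κ : ℝ) : EReal)

/-- Feasibility for DP. -/
structure DPPoint.Feasible (PS : S → ℝ) (PYX : X → Y → ℝ) (κ : S → X → Y → Sh → ℝ)
    (p : DPPoint S X Y Sh) : Prop where
  D1 : ∀ x s, p.gammaA s - ∑ y, p.lamB x s y - ∑ sh, ∑ y, p.mu s x y sh ≤ 0
  D2 : ∀ sh y, p.gammaB y - ∑ s, p.lamA s sh y - ∑ x, ∑ s, p.mu s x y sh ≤ 0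
  D3 : ∀ s x y sh, p.lamA s sh y + p.lamB x s y + p.mu s x y sh ≤ κ s x y sh * PS s * PYX x y
  mu_nonneg : ∀ s x y sh, 0 ≤ p.mu s x y sh

/-- The objective of DP. -/
def DPPoint.objective (p : DPPoint S X Y Sh) : ℝ :=
  ∑ s, p.gammaA s + ∑ y, p.gammaB y - ∑ s, ∑ x, ∑ y, ∑ sh, p.mu s x y sh

/-- `OPT(DP)`. -/
def optDP (PS : S → ℝ) (PYX : X → Y → ℝ) (κ : S → X → Y → Sh → ℝ) : EReal :=
  ⨆ (p : DPPoint S X Y Sh) (_ : p.Feasible PS PYX κ), ((p.objective : ℝ) : EReal)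

/-- The excess-distortion loss `I{d(s,ŝ) > 𝐝}`. -/
def excessLoss (d : S → Sh → ℝ≥0∞) (dd : ℝ) : S → X → Y → Sh → ℝ :=
  fun s _ _ sh => ind (ENNReal.ofReal dd < d s sh)

/-- The excess distortion probability `P[d(S,Ŝ) > 𝐝]` of a deterministic code `(f, g)`. -/
def excessProb (PS : S → ℝ) (PYX : X → Y → ℝ) (d : S → Sh → ℝ≥0∞) (dd : ℝ)
    (f : S → X) (g : Y → Sh) : ℝ :=
  ∑ s, ∑ y, PS s * PYX (f s) y * ind (ENNReal.ofReal dd < d s (g y))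

end Programs

/-! ### Rate-distortion function and tilted information -/

section Tilted

variable {S Sh : Type*} [Fintype S] [Fintype Sh]

/-- The law of `Ŝ` when `S ∼ P_S` and `Ŝ` has conditional law `W` given `S`. -/
def outputLaw (PS : S → ℝ) (W : S → Sh → ℝ) (sh : Sh) : ℝ := ∑ s, PS s * W s sh

/-- `I(S;Ŝ)` in nats; terms of probability zero contribute zero. -/
def mutualInfo (PS : S → ℝ) (W : S → Sh → ℝ) : ℝ :=
  ∑ s, ∑ sh, PS s * W s sh * Real.log (W s sh / outputLaw PS W sh)

/-- `E[d(S,Ŝ)]`, possibly `∞`, with `0 · ∞ = 0`. -/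
def expDistortion (PS : S → ℝ) (d : S → Sh → ℝ≥0∞) (W : S → Sh → ℝ) : ℝ≥0∞ :=
  ∑ s, ∑ sh, ENNReal.ofReal (PS s * W s sh) * d s sh

/-- The conditional distributions `P_{Ŝ|S}` with `E[d(S,Ŝ)] ≤ D`. -/
def admissible (PS : S → ℝ) (d : S → Sh → ℝ≥0∞) (D : ℝ) : Set (S → Sh → ℝ) :=
  {W | IsKernel W ∧ (expDistortion PS d W : EReal) ≤ (D : EReal)}

/-- The rate-distortion function `R_S(D)`, equal to `∞` if no conditional distribution is
admissible. -/
def rateDistortion (PS : S → ℝ) (d : S → Sh → ℝ≥0∞) (D : ℝ) : EReal :=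
  ⨅ W ∈ admissible PS d D, ((mutualInfo PS W : ℝ) : EReal)

/-- `d_min = inf {D : R_S(D) < ∞}`. -/
def dMin (PS : S → ℝ) (d : S → Sh → ℝ≥0∞) : EReal :=
  sInf ((fun D : ℝ => (D : EReal)) '' {D : ℝ | rateDistortion PS d D < ⊤})

/-- `W` attains the infimum that defines `R_S(D)`. -/
def AttainsRate (PS : S → ℝ) (d : S → Sh → ℝ≥0∞) (D : ℝ) (W : S → Sh → ℝ) : Prop :=
  W ∈ admissible PS d D ∧ ((mutualInfo PS W : ℝ) : EReal) = rateDistortion PS d D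

/-- The rate-distortion function as a real function (meaningful where `R_S` is finite, in
particular near every `D > d_min`). -/
def realRate (PS : S → ℝ) (d : S → Sh → ℝ≥0∞) (D : ℝ) : ℝ := (rateDistortion PS d D).toReal

/-- `λ* = -R_S'(𝐝)`. -/
def lamStar (PS : S → ℝ) (d : S → Sh → ℝ≥0∞) (dd : ℝ) : ℝ := -deriv (realRate PS d) dd

open Classical in
/-- `exp(l 𝐝 - l δ)`, with the value `0` at `δ = ∞`. -/
def tiltWeight (l dd : ℝ) (δ : ℝ≥0∞) : ℝ :=
  if δ = ⊤ then 0 else Real.exp (l * dd - l * δ.toReal)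

open Classical in
/-- The tilted information `j_S(s, 𝐝)`; `Wstar` is the conditional distribution that attains
`R_S(𝐝)`, and is not used when `𝐝 = 0`. (At letters `s` with `P_S(s) = 0` the value is immaterial.)
-/
def tiltedInfo (PS : S → ℝ) (d : S → Sh → ℝ≥0∞) (dd : ℝ) (Wstar : S → Sh → ℝ) (s : S) : ℝ :=
  if dd = 0 then Real.log (1 / PS s)
  else Real.log
    (1 / ∑ sh, outputLaw PS Wstar sh * tiltWeight (lamStar PS d dd) dd (d s sh))

/-- The situations in which the tilted information is defined: either `𝐝 > d_min`, the infimum in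
`R_S(𝐝)` is attained by `Wstar` and `R_S` has a derivative at `𝐝`; or `𝐝 = 0` and every destination
letter reproduces at most one source letter of positive probability with zero distortion. -/
def TiltedSetting (PS : S → ℝ) (d : S → Sh → ℝ≥0∞) (dd : ℝ) (Wstar : S → Sh → ℝ) : Prop :=
  (dMin PS d < (dd : EReal) ∧ AttainsRate PS d dd Wstar ∧
    DifferentiableAt ℝ (realRate PS d) dd) ∨
  (dd = 0 ∧ ∀ sh, {s | 0 < PS s ∧ d s sh = 0}.Subsingleton)

end Tilted

/-! ### Auxiliary variables and the two converse bounds -/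

section Bounds

variable {S X Y Sh : Type*} [Fintype S] [Fintype X] [Fintype Y] [Fintype Sh]

/-- An auxiliary variable `V` with `T` values, given by `P_{V|X}` and `P_{Y|X,V}` that are compatible
with the channel, together with output distributions `P_{Ȳ|V}`. -/
structure Auxiliary (PYX : X → Y → ℝ) (T : ℕ) where
  PVX : X → Fin T → ℝ
  PYXV : X → Fin T → Y → ℝ
  Pbar : Fin T → Y → ℝ
  isKernel_PVX : IsKernel PVX
  isKernel_PYXV : ∀ x, IsKernel (PYXV x)
  isKernel_Pbar : IsKernel Pbar
  channel_eq : ∀ x y, PYX x y = ∑ t, PYXV x t y * PVX x t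

variable {PYX : X → Y → ℝ} {T : ℕ}

/-- `i_{X;Ȳ|V}(x;y|t) = log (P_{Y|X=x,V=t}(y) / P_{Ȳ|V=t}(y))`, in `[-∞, ∞]`. -/
def infoDensity (A : Auxiliary PYX T) (x : X) (y : Y) (t : Fin T) : EReal :=
  ENNReal.log (ENNReal.ofReal (A.PYXV x t y) / ENNReal.ofReal (A.Pbar t y))

/-- `P[j - i_{X;Ȳ|V}(x;Y|V) ≥ γ]` under `P_{V|X=x} P_{Y|X=x,V}`. -/
def probGe (A : Auxiliary PYX T) (j γ : ℝ) (x : X) : ℝ :=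
  ∑ y, ∑ t, A.PVX x t * A.PYXV x t y * ind ((γ : EReal) ≤ (j : EReal) - infoDensity A x y t)

/-- The additional term
`exp(j - γ) ∑_y ∑_t P_{V|X}(t|x) P_{Ȳ|V}(y|t) I{j - i_{X;Ȳ|V}(x;y|t) < γ}`. -/
def extraTerm (A : Auxiliary PYX T) (j γ : ℝ) (x : X) : ℝ :=
  Real.exp (j - γ) *
    ∑ y, ∑ t, A.PVX x t * A.Pbar t y * ind ((j : EReal) - infoDensity A x y t < (γ : EReal))

/-- The expression maximized in the generalized Kostina-Verdú converse. -/
def kvValue (PS : S → ℝ) (j : S → ℝ) (A : Auxiliary PYX T) (γ : ℝ) : ℝ :=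
  ∑ s, PS s * (⨅ x, probGe A (j s) γ x) - T * Real.exp (-γ)

/-- The expression maximized in the improved converse. -/
def improvedValue (PS : S → ℝ) (j : S → ℝ) (A : Auxiliary PYX T) (γ : ℝ) : ℝ :=
  ∑ s, PS s * (⨅ x, (probGe A (j s) γ x + extraTerm A (j s) γ x)) - T * Real.exp (-γ)

/-- The generalized Kostina-Verdú converse (supremum over `γ > 0`, positive `T`, and `V`, `Ȳ`). -/
def kvBound (PS : S → ℝ) (PYX : X → Y → ℝ) (j : S → ℝ) : EReal :=
  ⨆ (γ : ℝ) (_ : 0 < γ) (T : ℕ) (_ : 0 < T) (A : Auxiliary PYX T),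
    ((kvValue PS j A γ : ℝ) : EReal)

/-- The improved converse (supremum over all real `γ`, positive `T`, and `V`, `Ȳ`). -/
def improvedBound (PS : S → ℝ) (PYX : X → Y → ℝ) (j : S → ℝ) : EReal :=
  ⨆ (γ : ℝ) (T : ℕ) (_ : 0 < T) (A : Auxiliary PYX T),
    ((improvedValue PS j A γ : ℝ) : EReal)

/-- `λᵇ(x,s,y)` of the explicit dual point. -/
def dualLamB (PS : S → ℝ) (j : S → ℝ) (A : Auxiliary PYX T) (γ : ℝ) (x : X) (s : S) (y : Y) : ℝ :=
  PS s * ∑ t,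
    (A.PYXV x t y * A.PVX x t * ind (A.PYXV x t y ≤ A.Pbar t y * Real.exp (j s - γ)) +
      A.Pbar t y * Real.exp (j s - γ) * A.PVX x t *
        ind (A.Pbar t y * Real.exp (j s - γ) < A.PYXV x t y))

/-- The explicit point of DP built from the tilted information `j`, the variable `V` and the output
distributions `P_{Ȳ|V}`. -/
def dualPoint (PS : S → ℝ) (d : S → Sh → ℝ≥0∞) (dd : ℝ) (j : S → ℝ) (A : Auxiliary PYX T) (γ : ℝ) :
    DPPoint S X Y Sh where
  gammaA s := ⨅ x, ∑ y, dualLamB PS j A γ x s y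
  gammaB y := -Real.exp (-γ) * ∑ t, A.Pbar t y
  lamA s sh y :=
    -(PS s * Real.exp (j s - γ) * ind (d s sh ≤ ENNReal.ofReal dd) * ∑ t, A.Pbar t y)
  lamB x s y := dualLamB PS j A γ x s y
  mu _ _ _ _ := 0

end Bounds

end JSCC

end

open scoped ENNReal

noncomputable section

namespace JSCC

/-! Two independent arguments meet at DP.

Duality. A randomized code gives an LP point with `W = Q_{X|S} Q_{Ŝ|Y}`, so LP relaxes SC; weak
duality is the usual pairing of constraints with nonnegative variables. For the converse direction,
adjoin "objective at least `v`" to the constraints of DP. By Farkas' lemma this finite system is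
solvable or has nonnegative multipliers witnessing inconsistency, and after normalization those
multipliers are an LP point of value below `v`. Taking `v = OPT(LP)` gives equality and a maximizer
of DP at once, without compactness. That maximizer is the single point that dominates every converse
bound.

The explicit point. Here `λᵇ = P_S ∑_t P_{V|X} min(P_{Y|X,V}, P_Ȳ e^{j-γ})`. Where the loss is 1,
the third constraint needs only `λᵇ ≤ P_S P_{Y|X}`; where the loss is 0, it needs only `λᵇ ≤ -λᵃ`.
The two arguments of the minimum give these bounds. The second constraint reduces to `∑_s P_S(s)
e^{j(s)} I{d(s,ŝ) ≤ 𝐝} ≤ 1` for every `ŝ`, the only property of tilted information that feasibility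
uses. Summing the minimum over `y` yields `P_S (p_γ + e_γ)`, hence the objective.

For `𝐝 = 0` that inequality is a count. Otherwise it is the Kuhn-Tucker condition at the optimal
output law. The tangent to `R_S` at `𝐝` turns the constrained minimum of `I` into an unconstrained
minimum of `I + λ* (E d - 𝐝)`. For a fixed output law the best conditional law is the exponential
tilt, so the optimal output law maximizes `Q ↦ ∑ P_S log E_Q[exp(λ*𝐝 - λ*d)]`. Differentiating
towards the point mass at `ŝ` gives the claim (`AttainsRate.sum_tiltWeight_div_le_one`). -/

/-! ### Farkas' lemma -/

/-- **Farkas' lemma**: a linear functional that is nonnegative wherever finitely many given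
functionals are nonnegative is a conic combination of them. -/
theorem exists_nonneg_combination {ι V : Type*} [AddCommGroup V] [Module ℝ V] (t : Finset ι) :
    ∀ (f : ι → V →ₗ[ℝ] ℝ) (g : V →ₗ[ℝ] ℝ),
      (∀ x, (∀ i ∈ t, 0 ≤ f i x) → 0 ≤ g x) →
      ∃ u : ι → ℝ, (∀ i, 0 ≤ u i) ∧ g = ∑ i ∈ t, u i • f i := by
  classical
  induction t using Finset.induction_on with
  | empty =>
    intro f g h
    refine ⟨0, fun _ => le_rfl, LinearMap.ext fun x => ?_⟩
    have h1 := h x (by simp)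
    have h2 := h (-x) (by simp)
    rw [map_neg] at h2
    simp only [Finset.sum_empty, LinearMap.zero_apply]
    linarith
  | insert a t ha ih =>
    intro f g h
    -- If the constraint `a` is redundant it gets weight zero; otherwise a point `x₀` violating `g`
    -- on the smaller cone must have `f a x₀ < 0`.
    by_cases hg : ∀ x, (∀ i ∈ t, 0 ≤ f i x) → 0 ≤ g x
    · obtain ⟨u, hu, rfl⟩ := ih f g hg
      refine ⟨Function.update u a 0, fun i => ?_, ?_⟩
      · rcases eq_or_ne i a with rfl | hi
        · simp
        · simpa [hi] using hu i
      · rw [Finset.sum_insert ha, Function.update_self, zero_smul, zero_add]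
        refine Finset.sum_congr rfl fun i hi => ?_
        rw [Function.update_of_ne (ne_of_mem_of_not_mem hi ha)]
    · push Not at hg
      obtain ⟨x₀, hx₀, hgx₀⟩ := hg
      have hfa : f a x₀ < 0 := by
        by_contra! hfa
        refine absurd (h x₀ fun i hi => ?_) (not_le.2 hgx₀)
        rcases Finset.mem_insert.1 hi with rfl | hi
        exacts [hfa, hx₀ i hi]
      have hc : 0 < -(f a x₀)⁻¹ := neg_pos.2 (inv_lt_zero.2 hfa)
      set c : ℝ := -(f a x₀)⁻¹ with hcdef
      have hcf : c * f a x₀ = -1 := by rw [hcdef, neg_mul, inv_mul_cancel₀ hfa.ne]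
      -- These are `f i` and `g` composed with the projection `x ↦ x + c (f a x) x₀` onto the kernel
      -- of `f a` along `x₀`, where the constraint `a` holds with equality.
      obtain ⟨u, hu, hgu⟩ := ih (fun i => f i + (c * f i x₀) • f a) (g + (c * g x₀) • f a) (by
        intro x hx
        have := h (x + (c * f a x) • x₀) (by
          intro i hi
          rcases Finset.mem_insert.1 hi with rfl | hi
          · rw [map_add, map_smul, smul_eq_mul]
            linear_combination (-f i x) * hcf
          · have := hx i hi
            simp only [map_add, map_smul, smul_eq_mul, LinearMap.add_apply,
              LinearMap.smul_apply] at this ⊢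
            linarith)
        simp only [map_add, map_smul, smul_eq_mul, LinearMap.add_apply,
          LinearMap.smul_apply] at this ⊢
        linarith)
      -- The coefficient of `f a` once the projections are expanded; both contributions are
      -- nonnegative.
      set r : ℝ := ∑ i ∈ t, u i * (c * f i x₀) - c * g x₀ with hr
      have hr0 : 0 ≤ r := by
        have : 0 ≤ ∑ i ∈ t, u i * (c * f i x₀) := Finset.sum_nonneg fun i hi =>
          mul_nonneg (hu i) (mul_nonneg hc.le (hx₀ i hi))
        have := mul_neg_of_pos_of_neg hc hgx₀
        linarith
      refine ⟨Function.update u a r, fun i => ?_, ?_⟩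
      · rcases eq_or_ne i a with rfl | hi
        · simpa using hr0
        · simpa [hi] using hu i
      · rw [Finset.sum_insert ha, Function.update_self]
        have : ∑ i ∈ t, Function.update u a r i • f i = ∑ i ∈ t, u i • f i :=
          Finset.sum_congr rfl fun i hi => by
            rw [Function.update_of_ne (ne_of_mem_of_not_mem hi ha)]
        rw [this, eq_sub_of_add_eq hgu, hr]
        ext x
        simp only [LinearMap.sub_apply, LinearMap.add_apply, LinearMap.smul_apply,
          LinearMap.sum_apply, smul_eq_mul, mul_add, Finset.sum_add_distrib, sub_mul,
          Finset.sum_mul, mul_assoc]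
        ring

/-- A finite system of linear inequalities is solvable, or its inconsistency is witnessed by
nonnegative multipliers. -/
theorem exists_solution_or_certificate {ι V : Type*} [Fintype ι] [AddCommGroup V] [Module ℝ V]
    (f : ι → V →ₗ[ℝ] ℝ) (c : ι → ℝ) :
    (∃ y, ∀ i, f i y ≤ c i) ∨
      ∃ u : ι → ℝ, (∀ i, 0 ≤ u i) ∧ (∀ y, ∑ i, u i * f i y = 0) ∧ ∑ i, u i * c i < 0 := by
  classical
  -- Homogenization: `f i y ≤ c i` becomes `0 ≤ c i * τ - f i y` with `τ ≥ 0`. The system is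
  -- unsolvable exactly when these force `τ ≤ 0`, and any point with `τ > 0` rescales to a solution.
  let F : Option ι → (V × ℝ) →ₗ[ℝ] ℝ := fun o => o.elim (LinearMap.snd ℝ V ℝ)
    fun i => c i • LinearMap.snd ℝ V ℝ - (f i).comp (LinearMap.fst ℝ V ℝ)
  by_cases h : ∀ x, (∀ i ∈ Finset.univ, 0 ≤ F i x) → 0 ≤ (-LinearMap.snd ℝ V ℝ) x
  · right
    obtain ⟨u, hu, hg⟩ := exists_nonneg_combination Finset.univ F _ h
    have hg' : ∀ y τ, -τ = u none * τ + ∑ i, u (some i) * (c i * τ - f i y) := by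
      intro y τ
      have := LinearMap.congr_fun hg (y, τ)
      simpa [F, Fintype.sum_option, LinearMap.sum_apply] using this
    refine ⟨fun i => u (some i), fun i => hu _, fun y => ?_, ?_⟩
    · have := hg' y 0
      simp only [neg_zero, mul_zero, zero_sub, mul_neg, Finset.sum_neg_distrib, zero_add] at this
      linarith
    · have := hg' 0 1
      simp only [mul_one, map_zero, sub_zero] at this
      have := hu none
      linarith
  · left
    push Not at h
    obtain ⟨⟨y, τ⟩, hF, hτ⟩ := h
    have hτ : 0 < τ := by simpa using hτ
    refine ⟨τ⁻¹ • y, fun i => ?_⟩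
    have := hF (some i) (Finset.mem_univ _)
    have : f i y ≤ c i * τ := by simpa [F] using this
    rw [map_smul, smul_eq_mul, inv_mul_le_iff₀ hτ]
    linarith

/-! ### Duality of the programs -/

section Duality

variable {S X Y Sh : Type*} [Fintype S] [Fintype X] [Fintype Y] [Fintype Sh]
  {PS : S → ℝ} {PYX : X → Y → ℝ} {κ : S → X → Y → Sh → ℝ}

theorem sum_comm_four (g : S → X → Y → Sh → ℝ) :
    ∑ s, ∑ x, ∑ y, ∑ sh, g s x y sh = ∑ y, ∑ sh, ∑ s, ∑ x, g s x y sh := by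
  calc ∑ s, ∑ x, ∑ y, ∑ sh, g s x y sh
      = ∑ s, ∑ y, ∑ x, ∑ sh, g s x y sh := Finset.sum_congr rfl fun s _ => Finset.sum_comm
    _ = ∑ y, ∑ s, ∑ x, ∑ sh, g s x y sh := Finset.sum_comm
    _ = ∑ y, ∑ s, ∑ sh, ∑ x, g s x y sh := Finset.sum_congr rfl fun y _ =>
      Finset.sum_congr rfl fun s _ => Finset.sum_comm
    _ = ∑ y, ∑ sh, ∑ s, ∑ x, g s x y sh := Finset.sum_congr rfl fun y _ => Finset.sum_comm

/-- Weak duality: each DP constraint is multiplied by its LP variable and the McCormick constraint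
by `mu`. After summation, the LP equalities cancel the `lamA` and `lamB` terms. -/
theorem DPPoint.objective_le_of_feasible {q : DPPoint S X Y Sh} (hq : q.Feasible PS PYX κ)
    {p : LPPoint S X Y Sh} (hp : p.Feasible) : q.objective ≤ p.objective PS PYX κ := by
  have h1 : ∑ s, ∑ x, p.QXS s x * (q.gammaA s - ∑ y, q.lamB x s y - ∑ sh, ∑ y, q.mu s x y sh)
      ≤ 0 := Finset.sum_nonpos fun s _ => Finset.sum_nonpos fun x _ =>
    mul_nonpos_of_nonneg_of_nonpos (hp.QXS_nonneg s x) (hq.D1 x s)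
  have h2 : ∑ y, ∑ sh, p.QShY y sh *
      (q.gammaB y - ∑ s, q.lamA s sh y - ∑ x, ∑ s, q.mu s x y sh) ≤ 0 :=
    Finset.sum_nonpos fun y _ => Finset.sum_nonpos fun sh _ =>
      mul_nonpos_of_nonneg_of_nonpos (hp.QShY_nonneg y sh) (hq.D2 sh y)
  have h3 : ∑ s, ∑ x, ∑ y, ∑ sh, p.W s x y sh * (q.lamA s sh y + q.lamB x s y + q.mu s x y sh)
      ≤ p.objective PS PYX κ := by
    refine Finset.sum_le_sum fun s _ => Finset.sum_le_sum fun x _ => Finset.sum_le_sum fun y _ =>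
      Finset.sum_le_sum fun sh _ => ?_
    rw [mul_comm]
    exact mul_le_mul_of_nonneg_right (hq.D3 s x y sh) (hp.W_nonneg s x y sh)
  have h4 : ∑ s, ∑ x, ∑ y, ∑ sh, q.mu s x y sh * (p.QXS s x + p.QShY y sh - p.W s x y sh)
      ≤ ∑ s, ∑ x, ∑ y, ∑ sh, q.mu s x y sh := by
    refine Finset.sum_le_sum fun s _ => Finset.sum_le_sum fun x _ => Finset.sum_le_sum fun y _ =>
      Finset.sum_le_sum fun sh _ => ?_
    exact mul_le_of_le_one_right (hq.mu_nonneg s x y sh) (hp.mccormick s x y sh)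
  have e1 : ∑ s, ∑ x, p.QXS s x * q.gammaA s = ∑ s, q.gammaA s := by
    refine Finset.sum_congr rfl fun s _ => ?_
    rw [← Finset.sum_mul, hp.sum_QXS, one_mul]
  have e2 : ∑ y, ∑ sh, p.QShY y sh * q.gammaB y = ∑ y, q.gammaB y := by
    refine Finset.sum_congr rfl fun s _ => ?_
    rw [← Finset.sum_mul, hp.sum_QShY, one_mul]
  have e3 : ∑ s, ∑ x, ∑ y, ∑ sh, p.W s x y sh * q.lamB x s y
      = ∑ s, ∑ x, ∑ y, p.QXS s x * q.lamB x s y := by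
    refine Finset.sum_congr rfl fun s _ => Finset.sum_congr rfl fun x _ =>
      Finset.sum_congr rfl fun y _ => ?_
    rw [← Finset.sum_mul, sub_eq_zero.1 (hp.sum_W_sh x s y)]
  have e4 : ∑ s, ∑ x, ∑ y, ∑ sh, p.W s x y sh * q.lamA s sh y
      = ∑ y, ∑ sh, ∑ s, p.QShY y sh * q.lamA s sh y := by
    rw [sum_comm_four]
    refine Finset.sum_congr rfl fun y _ => Finset.sum_congr rfl fun sh _ =>
      Finset.sum_congr rfl fun s _ => ?_
    rw [← Finset.sum_mul, sub_eq_zero.1 (hp.sum_W_x s sh y)]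
  have e5 : ∑ s, ∑ x, ∑ y, ∑ sh, q.mu s x y sh * p.QXS s x
      = ∑ s, ∑ x, ∑ sh, ∑ y, p.QXS s x * q.mu s x y sh := by
    refine Finset.sum_congr rfl fun s _ => Finset.sum_congr rfl fun x _ => ?_
    rw [Finset.sum_comm]
    simp only [mul_comm]
  have e6 : ∑ s, ∑ x, ∑ y, ∑ sh, q.mu s x y sh * p.QShY y sh
      = ∑ y, ∑ sh, ∑ x, ∑ s, p.QShY y sh * q.mu s x y sh := by
    rw [sum_comm_four]
    refine Finset.sum_congr rfl fun y _ => Finset.sum_congr rfl fun sh _ => ?_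
    rw [Finset.sum_comm]
    simp only [mul_comm]
  have e7 : ∑ s, ∑ x, ∑ y, ∑ sh, q.mu s x y sh * p.W s x y sh
      = ∑ s, ∑ x, ∑ y, ∑ sh, p.W s x y sh * q.mu s x y sh := by
    simp only [mul_comm]
  simp only [mul_sub, mul_add, Finset.sum_add_distrib, Finset.sum_sub_distrib, Finset.mul_sum]
    at h1 h2 h3 h4
  simp only [DPPoint.objective]
  linarith

theorem optDP_le_optLP : optDP (Sh := Sh) PS PYX κ ≤ optLP PS PYX κ :=
  iSup₂_le fun _ hq => le_iInf₂ fun _ hp =>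
    EReal.coe_le_coe_iff.2 (DPPoint.objective_le_of_feasible hq hp)

/-- The vector space underlying the variables of DP. -/
abbrev DPVector (S X Y Sh : Type*) :=
  (S → ℝ) × (Y → ℝ) × (S → Sh → Y → ℝ) × (X → S → Y → ℝ) × (S → X → Y → Sh → ℝ)

/-- The point of DP with the given vector of variables. -/
def DPVector.toPoint {S X Y Sh : Type*} (z : DPVector S X Y Sh) : DPPoint S X Y Sh :=
  ⟨z.1, z.2.1, z.2.2.1, z.2.2.2.1, z.2.2.2.2⟩

/-- If every feasible point of LP has objective at least `v`, then DP has a feasible point whose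
objective is at least `v`. -/
theorem exists_dual_feasible_ge (v : ℝ)
    (hv : ∀ p : LPPoint S X Y Sh, p.Feasible → v ≤ p.objective PS PYX κ) :
    ∃ q : DPPoint S X Y Sh, q.Feasible PS PYX κ ∧ v ≤ q.objective := by
  classical
  let f1 : S × X → DPVector S X Y Sh →ₗ[ℝ] ℝ := fun i =>
    { toFun := fun z => (DPVector.toPoint z).gammaA i.1 - ∑ y, (DPVector.toPoint z).lamB i.2 i.1 y
        - ∑ sh, ∑ y, (DPVector.toPoint z).mu i.1 i.2 y sh
      map_add' := fun z w => by
        simp only [DPVector.toPoint, Prod.fst_add, Prod.snd_add, Pi.add_apply,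
          Finset.sum_add_distrib]; ring
      map_smul' := fun r z => by
        simp only [DPVector.toPoint, Prod.smul_fst, Prod.smul_snd, Pi.smul_apply,
          smul_eq_mul, ← Finset.mul_sum, RingHom.id_apply]; ring }
  let f2 : Y × Sh → DPVector S X Y Sh →ₗ[ℝ] ℝ := fun i =>
    { toFun := fun z => (DPVector.toPoint z).gammaB i.1 - ∑ s, (DPVector.toPoint z).lamA s i.2 i.1
        - ∑ x, ∑ s, (DPVector.toPoint z).mu s x i.1 i.2
      map_add' := fun z w => by
        simp only [DPVector.toPoint, Prod.fst_add, Prod.snd_add, Pi.add_apply,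
          Finset.sum_add_distrib]; ring
      map_smul' := fun r z => by
        simp only [DPVector.toPoint, Prod.smul_fst, Prod.smul_snd, Pi.smul_apply,
          smul_eq_mul, ← Finset.mul_sum, RingHom.id_apply]; ring }
  let f3 : S × X × Y × Sh → DPVector S X Y Sh →ₗ[ℝ] ℝ := fun i =>
    { toFun := fun z => (DPVector.toPoint z).lamA i.1 i.2.2.2 i.2.2.1
        + (DPVector.toPoint z).lamB i.2.1 i.1 i.2.2.1
        + (DPVector.toPoint z).mu i.1 i.2.1 i.2.2.1 i.2.2.2
      map_add' := fun z w => by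
        simp only [DPVector.toPoint, Prod.fst_add, Prod.snd_add, Pi.add_apply]; ring
      map_smul' := fun r z => by
        simp only [DPVector.toPoint, Prod.smul_fst, Prod.smul_snd, Pi.smul_apply, smul_eq_mul,
          RingHom.id_apply]; ring }
  let f4 : S × X × Y × Sh → DPVector S X Y Sh →ₗ[ℝ] ℝ := fun i =>
    { toFun := fun z => -(DPVector.toPoint z).mu i.1 i.2.1 i.2.2.1 i.2.2.2
      map_add' := fun z w => by
        simp only [DPVector.toPoint, Prod.snd_add, Pi.add_apply]; ring
      map_smul' := fun r z => by
        simp only [DPVector.toPoint, Prod.smul_snd, Pi.smul_apply, smul_eq_mul,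
          RingHom.id_apply]; ring }
  let f5 : DPVector S X Y Sh →ₗ[ℝ] ℝ :=
    { toFun := fun z => -(DPVector.toPoint z).objective
      map_add' := fun z w => by
        simp only [DPVector.toPoint, DPPoint.objective, Prod.fst_add, Prod.snd_add, Pi.add_apply,
          Finset.sum_add_distrib]; ring
      map_smul' := fun r z => by
        simp only [DPVector.toPoint, DPPoint.objective, Prod.smul_fst, Prod.smul_snd, Pi.smul_apply,
          smul_eq_mul, ← Finset.mul_sum, RingHom.id_apply]; ring }
  let f : (S × X) ⊕ (Y × Sh) ⊕ (S × X × Y × Sh) ⊕ (S × X × Y × Sh) ⊕ Unit →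
      DPVector S X Y Sh →ₗ[ℝ] ℝ :=
    Sum.elim f1 (Sum.elim f2 (Sum.elim f3 (Sum.elim f4 fun _ => f5)))
  let c : (S × X) ⊕ (Y × Sh) ⊕ (S × X × Y × Sh) ⊕ (S × X × Y × Sh) ⊕ Unit → ℝ :=
    Sum.elim (fun _ => 0) (Sum.elim (fun _ => 0) (Sum.elim
      (fun i => κ i.1 i.2.1 i.2.2.1 i.2.2.2 * PS i.1 * PYX i.2.1 i.2.2.1)
      (Sum.elim (fun _ => 0) fun _ => -v)))
  rcases exists_solution_or_certificate f c with ⟨z, hz⟩ | ⟨u, hu, hf, hc⟩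
  · refine ⟨DPVector.toPoint z, ⟨fun x s => hz (.inl (s, x)), fun sh y => hz (.inr (.inl (y, sh))),
      fun s x y sh => hz (.inr (.inr (.inl (s, x, y, sh)))), fun s x y sh => ?_⟩, ?_⟩
    · exact neg_nonpos.1 (hz (.inr (.inr (.inr (.inl (s, x, y, sh))))))
    · exact neg_le_neg_iff.1 (hz (.inr (.inr (.inr (.inr ())))))
  · exfalso
    -- The multipliers `a`, `b`, `w` are the LP variables scaled by `r`, the multiplier of the
    -- objective row, and `m` is the slack in the McCormick constraint. Testing the vanishing
    -- combination on unit vectors recovers the LP constraints one at a time.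
    let a : S → X → ℝ := fun s x => u (.inl (s, x))
    let b : Y → Sh → ℝ := fun y sh => u (.inr (.inl (y, sh)))
    let w : S → X → Y → Sh → ℝ := fun s x y sh => u (.inr (.inr (.inl (s, x, y, sh))))
    let m : S → X → Y → Sh → ℝ := fun s x y sh => u (.inr (.inr (.inr (.inl (s, x, y, sh)))))
    let r : ℝ := u (.inr (.inr (.inr (.inr ()))))
    have hf' : ∀ q : DPPoint S X Y Sh,
        ∑ s, ∑ x, a s x * (q.gammaA s - ∑ y, q.lamB x s y - ∑ sh, ∑ y, q.mu s x y sh)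
        + (∑ y, ∑ sh, b y sh * (q.gammaB y - ∑ s, q.lamA s sh y - ∑ x, ∑ s, q.mu s x y sh)
        + (∑ s, ∑ x, ∑ y, ∑ sh, w s x y sh * (q.lamA s sh y + q.lamB x s y + q.mu s x y sh)
        + (∑ s, ∑ x, ∑ y, ∑ sh, m s x y sh * -q.mu s x y sh + r * -q.objective))) = 0 := by
      intro q
      have := hf (q.gammaA, q.gammaB, q.lamA, q.lamB, q.mu)
      simp only [Fintype.sum_sum_type, Fintype.sum_prod_type, Fintype.sum_unique] at this
      exact this
    have hc' : ∑ s, ∑ x, ∑ y, ∑ sh, w s x y sh * (κ s x y sh * PS s * PYX x y) + r * -v < 0 := by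
      simpa [c, Fintype.sum_sum_type, Fintype.sum_prod_type] using hc
    have ha : ∀ s, ∑ x, a s x = r := by
      intro s
      have := hf' ⟨Pi.single s 1, 0, 0, 0, 0⟩
      simp [DPPoint.objective, Pi.single_apply] at this
      linarith
    have hb : ∀ y, ∑ sh, b y sh = r := by
      intro y
      have := hf' ⟨0, Pi.single y 1, 0, 0, 0⟩
      simp [DPPoint.objective, Pi.single_apply] at this
      linarith
    have hwx : ∀ s sh y, ∑ x, w s x y sh = b y sh := by
      intro s sh y
      have := hf' ⟨0, 0, fun s' sh' y' =>
        if s' = s then if sh' = sh then if y' = y then 1 else 0 else 0 else 0, 0, 0⟩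
      simp [DPPoint.objective, Finset.sum_ite_irrel] at this
      linarith
    have hwsh : ∀ x s y, ∑ sh, w s x y sh = a s x := by
      intro x s y
      have := hf' ⟨0, 0, 0, fun x' s' y' =>
        if x' = x then if s' = s then if y' = y then 1 else 0 else 0 else 0, 0⟩
      simp [DPPoint.objective, Finset.sum_ite_irrel] at this
      linarith
    have hm : ∀ s x y sh, a s x + b y sh - w s x y sh = r - m s x y sh := by
      intro s x y sh
      have := hf' ⟨0, 0, 0, 0, fun s' x' y' sh' =>
        if s' = s then if x' = x then if y' = y then if sh' = sh then 1 else 0 else 0 else 0 else 0⟩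
      simp [DPPoint.objective, Finset.sum_ite_irrel] at this
      linarith
    have hr : 0 ≤ r := hu _
    -- If `r = 0` then `b` and hence `w` vanish, so the certificate reads `0 < 0`. If `r > 0`,
    -- dividing by `r` gives an LP point of value below `v`.
    rcases hr.eq_or_lt with hr | hr
    · have hb0 : ∀ y sh, b y sh = 0 := fun y sh =>
        (Finset.sum_eq_zero_iff_of_nonneg fun sh _ => hu _).1 ((hb y).trans hr.symm) sh
          (Finset.mem_univ _)
      have hw0 : ∀ s x y sh, w s x y sh = 0 := fun s x y sh =>
        (Finset.sum_eq_zero_iff_of_nonneg fun x _ => hu _).1 ((hwx s sh y).trans (hb0 y sh)) x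
          (Finset.mem_univ _)
      simp [hw0, ← hr] at hc'
    · have := hv ⟨fun s x => a s x / r, fun y sh => b y sh / r, fun s x y sh => w s x y sh / r⟩
        { sum_QXS := fun s => by simp only [← Finset.sum_div, ha, div_self hr.ne']
          sum_QShY := fun y => by simp only [← Finset.sum_div, hb, div_self hr.ne']
          sum_W_x := fun s sh y => by simp only [← Finset.sum_div, hwx, sub_self]
          sum_W_sh := fun x s y => by simp only [← Finset.sum_div, hwsh, sub_self]
          mccormick := fun s x y sh => by
            rw [← add_div, ← sub_div, hm, div_le_one hr]
            exact sub_le_self _ (hu _)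
          QXS_nonneg := fun s x => div_nonneg (hu _) hr.le
          QShY_nonneg := fun y sh => div_nonneg (hu _) hr.le
          W_nonneg := fun s x y sh => div_nonneg (hu _) hr.le }
      simp only [LPPoint.objective, mul_div_assoc', ← Finset.sum_div] at this
      rw [le_div_iff₀ hr] at this
      have e : ∑ s, ∑ x, ∑ y, ∑ sh, w s x y sh * (κ s x y sh * PS s * PYX x y)
          = ∑ s, ∑ x, ∑ y, ∑ sh, κ s x y sh * PS s * PYX x y * w s x y sh := by
        simp only [mul_comm]
      linarith

end Duality

/-! ### Mutual information and the rate-distortion function -/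

section Tilted

variable {S Sh : Type*} [Fintype S] [Fintype Sh] {PS : S → ℝ} {d : S → Sh → ℝ≥0∞}
  {W W' : S → Sh → ℝ} {Q : Sh → ℝ}

theorem IsKernel.nonneg {α β : Type*} [Fintype β] {k : α → β → ℝ} (hk : IsKernel k) (a : α)
    (b : β) : 0 ≤ k a b := (hk a).1 b

theorem IsKernel.sum_eq_one {α β : Type*} [Fintype β] {k : α → β → ℝ} (hk : IsKernel k) (a : α) :
    ∑ b, k a b = 1 := (hk a).2

theorem outputLaw_nonneg (hPS : PS ∈ stdSimplex ℝ S) (hW : IsKernel W) (sh : Sh) :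
    0 ≤ outputLaw PS W sh :=
  Finset.sum_nonneg fun s _ => mul_nonneg (hPS.1 s) (hW.nonneg s sh)

theorem sum_sum_mul_kernel (hPS : PS ∈ stdSimplex ℝ S) (hW : IsKernel W) :
    ∑ s, ∑ sh, PS s * W s sh = 1 := by
  simp_rw [← Finset.mul_sum, hW.sum_eq_one, mul_one, hPS.2]

theorem outputLaw_mem_stdSimplex (hPS : PS ∈ stdSimplex ℝ S) (hW : IsKernel W) :
    outputLaw PS W ∈ stdSimplex ℝ Sh := by
  refine ⟨outputLaw_nonneg hPS hW, ?_⟩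
  simp only [outputLaw]
  rw [Finset.sum_comm, sum_sum_mul_kernel hPS hW]

theorem kernel_eq_zero_of_outputLaw_eq_zero (hPS : PS ∈ stdSimplex ℝ S) (hW : IsKernel W)
    {s : S} {sh : Sh} (hs : PS s ≠ 0) (h : outputLaw PS W sh = 0) : W s sh = 0 := by
  have := (Finset.sum_eq_zero_iff_of_nonneg fun s _ =>
    mul_nonneg (hPS.1 s) (hW.nonneg s sh)).1 h s (Finset.mem_univ _)
  exact (mul_eq_zero.1 this).resolve_left hs

/-- The tangent inequality for `(a, b) ↦ a log (a / b)`. -/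
theorem mul_log_add_sub_le_mul_log_div {a b p : ℝ} (ha : 0 ≤ a) (hb : 0 ≤ b) (hp : 0 ≤ p)
    (hab : b = 0 → a = 0) (hap : p = 0 → a = 0) :
    a * Real.log p + a - b * p ≤ a * Real.log (a / b) := by
  rcases ha.eq_or_lt with rfl | ha
  · simpa using mul_nonneg hb hp
  have hb : 0 < b := hb.lt_of_ne fun h => ha.ne' (hab h.symm)
  have hp : 0 < p := hp.lt_of_ne fun h => ha.ne' (hap h.symm)
  -- `1 - 1/x ≤ log x` at `x = a / (b p)`. The support conditions in the statement handle the
  -- convention `Real.log 0 = 0`.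
  have h := Real.one_sub_inv_le_log_of_pos (div_pos ha (mul_pos hb hp))
  rw [← div_div, Real.log_div (div_pos ha hb).ne' hp.ne', div_div, inv_div] at h
  have h' := mul_le_mul_of_nonneg_left h ha.le
  rw [mul_sub, mul_one, mul_div_cancel₀ _ ha.ne', mul_sub] at h'
  linarith

/-- A variational lower bound on the mutual information. -/
theorem le_mutualInfo (hPS : PS ∈ stdSimplex ℝ S) (hW : IsKernel W) (p : S → Sh → ℝ)
    (hp : ∀ s sh, PS s ≠ 0 → 0 ≤ p s sh) (hp0 : ∀ s sh, PS s ≠ 0 → p s sh = 0 → W s sh = 0) :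
    ∑ s, ∑ sh, PS s * (W s sh * Real.log (p s sh) + W s sh - outputLaw PS W sh * p s sh)
      ≤ mutualInfo PS W := by
  refine Finset.sum_le_sum fun s _ => Finset.sum_le_sum fun sh _ => ?_
  rw [mul_assoc]
  by_cases hs : PS s = 0
  · simp [hs]
  exact mul_le_mul_of_nonneg_left (mul_log_add_sub_le_mul_log_div (hW.nonneg s sh)
    (outputLaw_nonneg hPS hW sh) (hp s sh hs) (kernel_eq_zero_of_outputLaw_eq_zero hPS hW hs)
    (hp0 s sh hs)) (hPS.1 s)

theorem mutualInfo_nonneg (hPS : PS ∈ stdSimplex ℝ S) (hW : IsKernel W) : 0 ≤ mutualInfo PS W := by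
  refine le_trans (le_of_eq ?_) (le_mutualInfo hPS hW (fun _ _ => 1) (fun _ _ _ => zero_le_one)
    fun _ _ _ h => absurd h one_ne_zero)
  simp only [Real.log_one, mul_zero, zero_add, mul_one, mul_sub, Finset.sum_sub_distrib]
  rw [sum_sum_mul_kernel hPS hW]
  simp_rw [← Finset.mul_sum, (outputLaw_mem_stdSimplex hPS hW).2, mul_one, hPS.2, sub_self]

/-- The mutual information is at most the relative entropy with respect to any reference output
law. -/
theorem mutualInfo_le (hPS : PS ∈ stdSimplex ℝ S) (hW : IsKernel W) (hQ : Q ∈ stdSimplex ℝ Sh)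
    (hQW : ∀ s sh, PS s ≠ 0 → Q sh = 0 → W s sh = 0) :
    mutualInfo PS W ≤ ∑ s, ∑ sh, PS s * W s sh * Real.log (W s sh / Q sh) := by
  have hq : ∀ sh, Q sh = 0 → outputLaw PS W sh = 0 := fun sh h =>
    Finset.sum_eq_zero fun s _ => by
      by_cases hs : PS s = 0
      · simp [hs]
      · simp [hQW s sh hs h]
  -- The gap in the claimed inequality is the relative entropy of the output law with respect to
  -- `Q`.
  have h1 : 0 ≤ ∑ sh, outputLaw PS W sh * Real.log (outputLaw PS W sh / Q sh) := by
    have : ∑ sh, (outputLaw PS W sh * Real.log 1 + outputLaw PS W sh - Q sh * 1)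
        ≤ ∑ sh, outputLaw PS W sh * Real.log (outputLaw PS W sh / Q sh) :=
      Finset.sum_le_sum fun sh _ => mul_log_add_sub_le_mul_log_div (outputLaw_nonneg hPS hW sh)
        (hQ.1 sh) zero_le_one (hq sh) fun h => absurd h one_ne_zero
    simpa [Finset.sum_sub_distrib, hQ.2, (outputLaw_mem_stdSimplex hPS hW).2] using this
  have h2 : ∑ s, ∑ sh, PS s * W s sh * Real.log (W s sh / Q sh) = mutualInfo PS W
      + ∑ sh, outputLaw PS W sh * Real.log (outputLaw PS W sh / Q sh) := by
    have : ∑ sh, outputLaw PS W sh * Real.log (outputLaw PS W sh / Q sh)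
        = ∑ s, ∑ sh, PS s * W s sh * Real.log (outputLaw PS W sh / Q sh) := by
      rw [Finset.sum_comm]
      refine Finset.sum_congr rfl fun sh _ => ?_
      rw [← Finset.sum_mul]; rfl
    rw [this, mutualInfo, ← Finset.sum_add_distrib]
    refine Finset.sum_congr rfl fun s _ => ?_
    rw [← Finset.sum_add_distrib]
    refine Finset.sum_congr rfl fun sh _ => ?_
    by_cases h : PS s * W s sh = 0
    · simp [h]
    have hs := left_ne_zero_of_mul h
    have hw := right_ne_zero_of_mul h
    have hq1 : Q sh ≠ 0 := fun h' => hw (hQW s sh hs h')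
    have hq2 : outputLaw PS W sh ≠ 0 := fun h' =>
      hw (kernel_eq_zero_of_outputLaw_eq_zero hPS hW hs h')
    rw [Real.log_div hw hq1, Real.log_div hw hq2, Real.log_div hq2 hq1]
    ring
  linarith

/-- The conditional distribution `(1 - t) W + t W'`. -/
def mixKernel (t : ℝ) (W W' : S → Sh → ℝ) (s : S) (sh : Sh) : ℝ :=
  (1 - t) * W s sh + t * W' s sh

theorem isKernel_mixKernel {S Sh : Type*} [Fintype Sh] {W W' : S → Sh → ℝ} (hW : IsKernel W)
    (hW' : IsKernel W') {t : ℝ} (h0 : 0 ≤ t) (h1 : t ≤ 1) : IsKernel (mixKernel t W W') := fun s =>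
  ⟨fun sh => add_nonneg (mul_nonneg (sub_nonneg.2 h1) (hW.nonneg s sh))
    (mul_nonneg h0 (hW'.nonneg s sh)), by
    simp only [mixKernel, Finset.sum_add_distrib, ← Finset.mul_sum, hW.sum_eq_one,
      hW'.sum_eq_one]
    ring⟩

theorem outputLaw_mixKernel {S Sh : Type*} [Fintype S] {PS : S → ℝ} {W W' : S → Sh → ℝ}
    (t : ℝ) (sh : Sh) : outputLaw PS (mixKernel t W W') sh =
       (1 - t) * outputLaw PS W sh + t * outputLaw PS W' sh := by
  simp only [outputLaw, mixKernel, Finset.mul_sum, ← Finset.sum_add_distrib]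
  exact Finset.sum_congr rfl fun s _ => by ring

/-- The mutual information is convex in the conditional distribution. -/
theorem mutualInfo_mixKernel_le (hPS : PS ∈ stdSimplex ℝ S) (hW : IsKernel W) (hW' : IsKernel W')
    {t : ℝ} (h0 : 0 < t) (h1 : t < 1) : mutualInfo PS (mixKernel t W W')
      ≤ (1 - t) * mutualInfo PS W + t * mutualInfo PS W' := by
  have hM : IsKernel (mixKernel t W W') := isKernel_mixKernel hW hW' h0.le h1.le
  have h1' : 0 < 1 - t := sub_pos.2 h1
  set M := mixKernel t W W' with hMdef
  -- The variational bound with this `p` is affine in the conditional distribution and tight at the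
  -- mixture, so it is a supporting functional there. Applying it to `W` and `W'` gives convexity.
  let p : S → Sh → ℝ := fun s sh => M s sh / outputLaw PS M sh
  have hp : ∀ s sh, PS s ≠ 0 → 0 ≤ p s sh := fun s sh _ =>
    div_nonneg (hM.nonneg s sh) (outputLaw_nonneg hPS hM sh)
  have hpM : ∀ s sh, PS s ≠ 0 → p s sh = 0 → M s sh = 0 := fun s sh hs h =>
    (div_eq_zero_iff.1 h).elim id (kernel_eq_zero_of_outputLaw_eq_zero hPS hM hs)
  have hz : ∀ s sh, M s sh = 0 → W s sh = 0 ∧ W' s sh = 0 := fun s sh h => by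
    have h2 := mul_nonneg h1'.le (hW.nonneg s sh)
    have h3 := mul_nonneg h0.le (hW'.nonneg s sh)
    have h4 : (1 - t) * W s sh + t * W' s sh = 0 := h
    exact ⟨(mul_eq_zero.1 (by linarith : (1 - t) * W s sh = 0)).resolve_left h1'.ne',
      (mul_eq_zero.1 (by linarith : t * W' s sh = 0)).resolve_left h0.ne'⟩
  have e1 := mul_le_mul_of_nonneg_left
    (le_mutualInfo hPS hW p hp fun s sh hs h => (hz s sh (hpM s sh hs h)).1) h1'.le
  have e2 := mul_le_mul_of_nonneg_left
    (le_mutualInfo hPS hW' p hp fun s sh hs h => (hz s sh (hpM s sh hs h)).2) h0.le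
  refine le_trans (le_of_eq ?_) (add_le_add e1 e2)
  simp only [mutualInfo, Finset.mul_sum, ← Finset.sum_add_distrib]
  refine Finset.sum_congr rfl fun s _ => Finset.sum_congr rfl fun sh _ => ?_
  by_cases hs : PS s = 0
  · simp [hs]
  have hMp : M s sh - outputLaw PS M sh * p s sh = 0 := by
    by_cases h : outputLaw PS M sh = 0
    · simp [h, kernel_eq_zero_of_outputLaw_eq_zero hPS hM hs h]
    · rw [mul_div_cancel₀ _ h, sub_self]
  rw [outputLaw_mixKernel] at hMp
  have hMv : M s sh = (1 - t) * W s sh + t * W' s sh := rfl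
  change PS s * M s sh * Real.log (p s sh) = _
  rw [hMv] at hMp ⊢
  linear_combination (-PS s) * hMp

/-! ### Expected distortion -/

/-- The expected distortion as a real number, infinite distortions being ignored. -/
def realDistortion (PS : S → ℝ) (d : S → Sh → ℝ≥0∞) (W : S → Sh → ℝ) : ℝ :=
  ∑ s, ∑ sh, PS s * W s sh * (d s sh).toReal

/-- Infinite distortion has probability zero. -/
def FiniteDistortion (PS : S → ℝ) (d : S → Sh → ℝ≥0∞) (W : S → Sh → ℝ) : Prop :=
  ∀ s sh, PS s * W s sh ≠ 0 → d s sh ≠ ⊤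

theorem realDistortion_nonneg (hPS : PS ∈ stdSimplex ℝ S) (hW : IsKernel W) :
    0 ≤ realDistortion PS d W :=
  Finset.sum_nonneg fun s _ => Finset.sum_nonneg fun sh _ =>
    mul_nonneg (mul_nonneg (hPS.1 s) (hW.nonneg s sh)) ENNReal.toReal_nonneg

theorem expDistortion_eq_ofReal (hPS : PS ∈ stdSimplex ℝ S) (hW : IsKernel W)
    (h : FiniteDistortion PS d W) :
    expDistortion PS d W = ENNReal.ofReal (realDistortion PS d W) := by
  have h0 : ∀ s sh, 0 ≤ PS s * W s sh * (d s sh).toReal := fun s sh =>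
    mul_nonneg (mul_nonneg (hPS.1 s) (hW.nonneg s sh)) ENNReal.toReal_nonneg
  rw [realDistortion, ENNReal.ofReal_sum_of_nonneg fun s _ => Finset.sum_nonneg fun sh _ => h0 s sh]
  refine Finset.sum_congr rfl fun s _ => ?_
  rw [ENNReal.ofReal_sum_of_nonneg fun sh _ => h0 s sh]
  refine Finset.sum_congr rfl fun sh _ => ?_
  rw [ENNReal.ofReal_mul (mul_nonneg (hPS.1 s) (hW.nonneg s sh))]
  by_cases hz : PS s * W s sh = 0
  · simp [hz]
  · rw [ENNReal.ofReal_toReal (h s sh hz)]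

theorem finiteDistortion_of_ne_top (hPS : PS ∈ stdSimplex ℝ S) (hW : IsKernel W)
    (h : expDistortion PS d W ≠ ⊤) : FiniteDistortion PS d W := by
  intro s sh hne hd
  have h1 := ENNReal.sum_ne_top.1 (ENNReal.sum_ne_top.1 h s (Finset.mem_univ _)) sh
    (Finset.mem_univ _)
  have h2 : 0 < PS s * W s sh :=
    (mul_nonneg (hPS.1 s) (hW.nonneg s sh)).lt_of_ne hne.symm
  rw [hd, ENNReal.mul_top (ENNReal.ofReal_pos.2 h2).ne'] at h1
  exact h1 rfl

/-- Trades the extended-valued constraint for a support condition and an inequality linear in `W`,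
which mixtures respect. -/
theorem mem_admissible_iff (hPS : PS ∈ stdSimplex ℝ S) {D : ℝ} : W ∈ admissible PS d D ↔
    IsKernel W ∧ FiniteDistortion PS d W ∧ realDistortion PS d W ≤ D := by
  refine and_congr_right fun hW => ⟨fun h => ?_, fun ⟨h1, h2⟩ => ?_⟩
  · have hf : FiniteDistortion PS d W := finiteDistortion_of_ne_top hPS hW fun ht => by
      rw [ht] at h
      exact EReal.coe_ne_top D (top_le_iff.1 h)
    rw [expDistortion_eq_ofReal hPS hW hf, EReal.coe_ennreal_ofReal,
      max_eq_left (realDistortion_nonneg hPS hW), EReal.coe_le_coe_iff] at h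
    exact ⟨hf, h⟩
  · rw [expDistortion_eq_ofReal hPS hW h1, EReal.coe_ennreal_ofReal,
      max_eq_left (realDistortion_nonneg hPS hW), EReal.coe_le_coe_iff]
    exact h2

theorem mixKernel_mem_admissible (hPS : PS ∈ stdSimplex ℝ S) {D D' t : ℝ}
    (hW : W ∈ admissible PS d D) (hW' : W' ∈ admissible PS d D') (h0 : 0 ≤ t) (h1 : t ≤ 1) :
    mixKernel t W W' ∈ admissible PS d ((1 - t) * D + t * D') := by
  rw [mem_admissible_iff hPS] at hW hW' ⊢
  refine ⟨isKernel_mixKernel hW.1 hW'.1 h0 h1, fun s sh h => ?_, ?_⟩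
  · by_contra! hd
    have h2 : PS s * W s sh = 0 := by_contra fun hne => hW.2.1 s sh hne hd
    have h3 : PS s * W' s sh = 0 := by_contra fun hne => hW'.2.1 s sh hne hd
    refine h ?_
    rw [mixKernel]
    linear_combination (1 - t) * h2 + t * h3
  · have : realDistortion PS d (mixKernel t W W')
        = (1 - t) * realDistortion PS d W + t * realDistortion PS d W' := by
      simp only [realDistortion, mixKernel, Finset.mul_sum, ← Finset.sum_add_distrib]
      exact Finset.sum_congr rfl fun s _ => Finset.sum_congr rfl fun sh _ => by ring
    rw [this]
    exact add_le_add (mul_le_mul_of_nonneg_left hW.2.2 (sub_nonneg.2 h1))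
      (mul_le_mul_of_nonneg_left hW'.2.2 h0)

/-! ### The slope of the rate-distortion function -/

theorem realRate_le_mutualInfo (hPS : PS ∈ stdSimplex ℝ S) {D : ℝ} (hW : W ∈ admissible PS d D) :
    realRate PS d D ≤ mutualInfo PS W := by
  have h0 : 0 ≤ rateDistortion PS d D := le_iInf₂ fun W hW =>
    EReal.coe_nonneg.2 (mutualInfo_nonneg hPS hW.1)
  have h1 : rateDistortion PS d D ≤ (mutualInfo PS W : EReal) := iInf₂_le W hW
  exact EReal.toReal_le_toReal h1 (ne_bot_of_le_ne_bot EReal.zero_ne_bot h0) (EReal.coe_ne_top _)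

theorem AttainsRate.realRate_eq {D : ℝ} (hW : AttainsRate PS d D W) :
    realRate PS d D = mutualInfo PS W := by
  rw [realRate, ← hW.2, EReal.toReal_coe]

/-- The tangent to the rate-distortion function at a point where it is attained bounds the mutual
information from below. -/
theorem AttainsRate.deriv_mul_le (hPS : PS ∈ stdSimplex ℝ S) {dd D : ℝ}
    (hW : AttainsRate PS d dd W) (hd : DifferentiableAt ℝ (realRate PS d) dd)
    (hW' : W' ∈ admissible PS d D) :
    deriv (realRate PS d) dd * (D - dd) ≤ mutualInfo PS W' - mutualInfo PS W := by
  have hg : HasDerivAt (fun t : ℝ => realRate PS d (dd + t * (D - dd)))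
      (deriv (realRate PS d) dd * (D - dd)) 0 := by
    have h1 : HasDerivAt (fun t : ℝ => dd + t * (D - dd)) (D - dd) 0 := by
      simpa using ((hasDerivAt_id (0 : ℝ)).mul_const (D - dd)).const_add dd
    have h2 : HasDerivAt (realRate PS d) (deriv (realRate PS d) dd)
        (dd + 0 * (D - dd)) := by simpa using hd.hasDerivAt
    exact h2.comp 0 h1
  -- Along the mixtures of `W` and `W'`, convexity of `mutualInfo` bounds every right difference
  -- quotient of `realRate` by the right-hand side.
  refine le_of_tendsto hg.tendsto_slope_zero_right ?_
  filter_upwards [Ioo_mem_nhdsGT (zero_lt_one (α := ℝ))] with t ht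
  have h1 := realRate_le_mutualInfo hPS (mixKernel_mem_admissible hPS hW.1 hW' ht.1.le ht.2.le)
  have h2 := mutualInfo_mixKernel_le hPS hW.1.1 hW'.1 ht.1 ht.2
  have h3 : (1 - t) * dd + t * D = dd + (0 + t) * (D - dd) := by ring
  rw [h3] at h1
  rw [smul_eq_mul, zero_mul, add_zero, hW.realRate_eq, inv_mul_le_iff₀ ht.1]
  linarith

/-! ### Tilting -/

theorem tiltWeight_nonneg (l dd : ℝ) (δ : ℝ≥0∞) : 0 ≤ tiltWeight l dd δ := by
  rw [tiltWeight]; split_ifs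
  exacts [le_rfl, (Real.exp_pos _).le]

theorem tiltWeight_eq_zero_iff {l dd : ℝ} {δ : ℝ≥0∞} : tiltWeight l dd δ = 0 ↔ δ = ⊤ := by
  rw [tiltWeight]; split_ifs with h <;> simp [h]

theorem log_tiltWeight {l dd : ℝ} {δ : ℝ≥0∞} (h : δ ≠ ⊤) :
    Real.log (tiltWeight l dd δ) = l * dd - l * δ.toReal := by
  rw [tiltWeight, if_neg h, Real.log_exp]

theorem ind_le_tiltWeight {l dd : ℝ} (hl : 0 ≤ l) (hdd : 0 ≤ dd) (δ : ℝ≥0∞) :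
    ind (δ ≤ ENNReal.ofReal dd) ≤ tiltWeight l dd δ := by
  rw [ind]
  split_ifs with h
  · have hδ : δ ≠ ⊤ := ne_top_of_le_ne_top ENNReal.ofReal_ne_top h
    rw [tiltWeight, if_neg hδ, Real.one_le_exp_iff, sub_nonneg]
    exact mul_le_mul_of_nonneg_left (ENNReal.toReal_le_of_le_ofReal hdd h) hl
  · exact tiltWeight_nonneg _ _ _

/-- The expectation `E[exp(l 𝐝 - l d(s,Ŝ))]` when `Ŝ` has law `Q`. -/
def tiltMean (d : S → Sh → ℝ≥0∞) (l dd : ℝ) (Q : Sh → ℝ) (s : S) : ℝ :=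
  ∑ sh, Q sh * tiltWeight l dd (d s sh)

variable {l dd : ℝ}

theorem tiltMean_outputLaw_pos (hPS : PS ∈ stdSimplex ℝ S) (hW : IsKernel W)
    (hf : FiniteDistortion PS d W) {s : S} (hs : PS s ≠ 0) :
    0 < tiltMean d l dd (outputLaw PS W) s := by
  have h0 : ∀ sh, 0 ≤ outputLaw PS W sh * tiltWeight l dd (d s sh) := fun sh =>
    mul_nonneg (outputLaw_nonneg hPS hW sh) (tiltWeight_nonneg _ _ _)
  refine (Finset.sum_nonneg fun sh _ => h0 sh).lt_of_ne fun h => ?_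
  have h1 := (Finset.sum_eq_zero_iff_of_nonneg fun sh _ => h0 sh).1 h.symm
  have h2 : ∑ sh, W s sh = 0 := Finset.sum_eq_zero fun sh hsh => by
    by_contra hw
    rcases mul_eq_zero.1 (h1 sh hsh) with h3 | h3
    · exact hw (kernel_eq_zero_of_outputLaw_eq_zero hPS hW hs h3)
    · exact hf s sh (mul_ne_zero hs hw) (tiltWeight_eq_zero_iff.1 h3)
  rw [hW.sum_eq_one] at h2
  exact one_ne_zero h2

/-- The variational bound with `p` the tilting weight over its mean. Normalization makes the linear
terms cancel, and finite distortion makes `log p` affine in the distortion on the support of `W`. -/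
theorem neg_sum_log_tiltMean_le (hPS : PS ∈ stdSimplex ℝ S) (hW : IsKernel W)
    (hf : FiniteDistortion PS d W) :
    -∑ s, PS s * Real.log (tiltMean d l dd (outputLaw PS W) s)
      ≤ mutualInfo PS W + l * (realDistortion PS d W - dd) := by
  set a := tiltMean d l dd (outputLaw PS W) with ha
  have ha0 : ∀ s, PS s ≠ 0 → 0 < a s := fun s hs => tiltMean_outputLaw_pos hPS hW hf hs
  have key := le_mutualInfo hPS hW (fun s sh => tiltWeight l dd (d s sh) / a s)
    (fun s sh hs => div_nonneg (tiltWeight_nonneg _ _ _) (ha0 s hs).le)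
    (fun s sh hs h => by
      rw [div_eq_zero_iff, or_iff_left (ha0 s hs).ne', tiltWeight_eq_zero_iff] at h
      by_contra hw
      exact hf s sh (mul_ne_zero hs hw) h)
  refine sub_le_iff_le_add.1 (le_trans (le_of_eq ?_) key)
  have e1 : l * (realDistortion PS d W - dd)
      = ∑ s, (∑ sh, l * (PS s * W s sh * (d s sh).toReal) - PS s * (l * dd)) := by
    rw [Finset.sum_sub_distrib, ← Finset.sum_mul, hPS.2, realDistortion]
    simp only [Finset.mul_sum, mul_sub, one_mul]
  rw [e1, ← Finset.sum_neg_distrib, ← Finset.sum_sub_distrib]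
  refine Finset.sum_congr rfl fun s _ => ?_
  by_cases hs : PS s = 0
  · simp [hs]
  have e2 : ∀ sh, PS s * (W s sh * Real.log (tiltWeight l dd (d s sh) / a s) + W s sh
      - outputLaw PS W sh * (tiltWeight l dd (d s sh) / a s))
      = PS s * W s sh * (l * dd - Real.log (a s) + 1) - l * (PS s * W s sh * (d s sh).toReal)
        - PS s / a s * (outputLaw PS W sh * tiltWeight l dd (d s sh)) := by
    intro sh
    by_cases hw : W s sh = 0
    · simp only [hw]; ring
    have hd := hf s sh (mul_ne_zero hs hw)
    rw [Real.log_div (fun h => hd (tiltWeight_eq_zero_iff.1 h)) (ha0 s hs).ne', log_tiltWeight hd]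
    ring
  rw [Finset.sum_congr rfl fun sh _ => e2 sh, Finset.sum_sub_distrib, Finset.sum_sub_distrib,
    ← Finset.mul_sum, ← Finset.sum_mul, ← Finset.mul_sum, hW.sum_eq_one]
  have e3 : ∑ sh, outputLaw PS W sh * tiltWeight l dd (d s sh) = a s := rfl
  rw [← Finset.mul_sum, e3, div_mul_cancel₀ _ (ha0 s hs).ne']
  ring

open Classical in
/-- The conditional distribution obtained from `Q` by exponential tilting. -/
def tiltKernel (PS : S → ℝ) (d : S → Sh → ℝ≥0∞) (l dd : ℝ) (Q : Sh → ℝ) (s : S) (sh : Sh) : ℝ :=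
  -- At letters of probability zero the tilted mean may vanish; `Q` keeps this a conditional
  -- distribution.
  if PS s = 0 then Q sh else Q sh * tiltWeight l dd (d s sh) / tiltMean d l dd Q s

theorem isKernel_tiltKernel {S Sh : Type*} [Fintype Sh] {PS : S → ℝ} {d : S → Sh → ℝ≥0∞}
    {Q : Sh → ℝ} {l dd : ℝ} (hQ : Q ∈ stdSimplex ℝ Sh)
    (ha : ∀ s, PS s ≠ 0 → 0 < tiltMean d l dd Q s) : IsKernel (tiltKernel PS d l dd Q) := by
  intro s
  by_cases hs : PS s = 0
  · have : tiltKernel PS d l dd Q s = Q := funext fun sh => if_pos hs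
    rwa [this]
  · have : tiltKernel PS d l dd Q s
        = fun sh => Q sh * tiltWeight l dd (d s sh) / tiltMean d l dd Q s :=
      funext fun sh => if_neg hs
    rw [this]
    refine ⟨fun sh => div_nonneg (mul_nonneg (hQ.1 sh) (tiltWeight_nonneg _ _ _)) (ha s hs).le, ?_⟩
    rw [← Finset.sum_div]
    exact div_self (ha s hs).ne'

theorem tiltKernel_ne_zero {S Sh : Type*} [Fintype Sh] {PS : S → ℝ} {d : S → Sh → ℝ≥0∞}
    {Q : Sh → ℝ} {l dd : ℝ} {s : S} {sh : Sh} (h : PS s * tiltKernel PS d l dd Q s sh ≠ 0) :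
    Q sh ≠ 0 ∧ d s sh ≠ ⊤ := by
  have hs := left_ne_zero_of_mul h
  have hw := right_ne_zero_of_mul h
  rw [tiltKernel, if_neg hs, div_eq_mul_inv] at hw
  have h1 := left_ne_zero_of_mul hw
  exact ⟨left_ne_zero_of_mul h1, fun h2 =>
    right_ne_zero_of_mul h1 (tiltWeight_eq_zero_iff.2 h2)⟩

/-- Relative to the reference law `Q`, the log-density of the tilted kernel is `l * dd - l * d`
minus the log of the mean, so the distortion term cancels exactly. Only replacing `Q` by the true
output law loses anything. -/
theorem mutualInfo_tiltKernel_le (hPS : PS ∈ stdSimplex ℝ S) (hQ : Q ∈ stdSimplex ℝ Sh)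
    (ha : ∀ s, PS s ≠ 0 → 0 < tiltMean d l dd Q s) :
    mutualInfo PS (tiltKernel PS d l dd Q)
        + l * (realDistortion PS d (tiltKernel PS d l dd Q) - dd)
      ≤ -∑ s, PS s * Real.log (tiltMean d l dd Q s) := by
  set W := tiltKernel PS d l dd Q with hW
  have hK : IsKernel W := isKernel_tiltKernel hQ ha
  have h1 := mutualInfo_le hPS hK hQ fun s sh hs h => by
    by_contra hw
    exact (tiltKernel_ne_zero (mul_ne_zero hs hw)).1 h
  refine le_trans (add_le_add_left h1 _) (le_of_eq ?_)
  have e1 : l * (realDistortion PS d W - dd)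
      = ∑ s, ∑ sh, PS s * W s sh * (l * (d s sh).toReal - l * dd) := by
    simp only [mul_sub, Finset.sum_sub_distrib, ← Finset.sum_mul]
    rw [sum_sum_mul_kernel hPS hK, realDistortion, one_mul]
    simp only [Finset.mul_sum]
    congr 1
    exact Finset.sum_congr rfl fun s _ => Finset.sum_congr rfl fun sh _ => by ring
  rw [e1, ← Finset.sum_add_distrib, ← Finset.sum_neg_distrib]
  refine Finset.sum_congr rfl fun s _ => ?_
  rw [← Finset.sum_add_distrib]
  have e2 : ∀ sh, PS s * W s sh * Real.log (W s sh / Q sh)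
      + PS s * W s sh * (l * (d s sh).toReal - l * dd)
      = -(PS s * Real.log (tiltMean d l dd Q s)) * W s sh := by
    intro sh
    by_cases h : PS s * W s sh = 0
    · rw [h]; linear_combination Real.log (tiltMean d l dd Q s) * h
    obtain ⟨hq, hd⟩ := tiltKernel_ne_zero h
    have hs := left_ne_zero_of_mul h
    have e3 : W s sh / Q sh = tiltWeight l dd (d s sh) / tiltMean d l dd Q s := by
      rw [hW, tiltKernel, if_neg hs, div_right_comm, mul_div_cancel_left₀ _ hq]
    rw [e3, Real.log_div (fun h => hd (tiltWeight_eq_zero_iff.1 h)) (ha s hs).ne',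
      log_tiltWeight hd]
    ring
  rw [Finset.sum_congr rfl fun sh _ => e2 sh, ← Finset.mul_sum, hK.sum_eq_one, mul_one]

/-- The optimal `W` stays admissible at `dd + 1`, and the tangent inequality comparing it with
itself makes the derivative nonpositive. -/
theorem lamStar_nonneg (hPS : PS ∈ stdSimplex ℝ S) (hW : AttainsRate PS d dd W)
    (hd : DifferentiableAt ℝ (realRate PS d) dd) : 0 ≤ lamStar PS d dd := by
  have h1 : W ∈ admissible PS d (dd + 1) := by
    have := (mem_admissible_iff hPS).1 hW.1
    exact (mem_admissible_iff hPS).2 ⟨this.1, this.2.1, by linarith⟩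
  have h2 := hW.deriv_mul_le hPS hd h1
  rw [lamStar]
  linarith

/-- The output law of an optimal conditional distribution maximizes the expected logarithm of the
tilted mean. -/
theorem AttainsRate.sum_log_tiltMean_le (hPS : PS ∈ stdSimplex ℝ S) (hW : AttainsRate PS d dd W)
    (hd : DifferentiableAt ℝ (realRate PS d) dd) (hQ : Q ∈ stdSimplex ℝ Sh)
    (ha : ∀ s, PS s ≠ 0 → 0 < tiltMean d (lamStar PS d dd) dd Q s) :
    ∑ s, PS s * Real.log (tiltMean d (lamStar PS d dd) dd Q s)
      ≤ ∑ s, PS s * Real.log (tiltMean d (lamStar PS d dd) dd (outputLaw PS W) s) := by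
  obtain ⟨hK, hf, hD⟩ := (mem_admissible_iff hPS).1 hW.1
  -- With `l = λ*`: `-∑ log a_W ≤ I(W) ≤ I(tilt) + l (E d - dd) ≤ -∑ log a_Q`, the middle step being
  -- the tangent inequality at the distortion of the tilted kernel.
  have h1 := neg_sum_log_tiltMean_le (l := lamStar PS d dd) (dd := dd) hPS hK hf
  have h2 := mutualInfo_tiltKernel_le hPS hQ ha
  have h3 := hW.deriv_mul_le hPS hd ((mem_admissible_iff hPS).2
    ⟨isKernel_tiltKernel hQ ha, fun s sh h => (tiltKernel_ne_zero h).2, le_rfl⟩)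
  have h4 := mul_nonneg (lamStar_nonneg hPS hW hd) (sub_nonneg.2 hD)
  have h5 : deriv (realRate PS d) dd = -lamStar PS d dd := by rw [lamStar, neg_neg]
  rw [h5] at h3
  linarith

open Filter Topology in
-- First-order optimality of the output law. Moving mass `ε` to `sh` multiplies the tilted mean by
-- `1 + ε (r - 1)`, with `r` the ratio in the statement. Since the expected logarithm cannot
-- increase, `log x ≥ 1 - 1/x` and `ε → 0` give `∑ PS (r - 1) ≤ 0`.
theorem AttainsRate.sum_tiltWeight_div_le_one (hPS : PS ∈ stdSimplex ℝ S)
    (hW : AttainsRate PS d dd W) (hd : DifferentiableAt ℝ (realRate PS d) dd) (sh : Sh) :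
    ∑ s, PS s * (tiltWeight (lamStar PS d dd) dd (d s sh)
      / tiltMean d (lamStar PS d dd) dd (outputLaw PS W) s) ≤ 1 := by
  classical
  obtain ⟨hK, hf, -⟩ := (mem_admissible_iff hPS).1 hW.1
  set l := lamStar PS d dd
  set a := tiltMean d l dd (outputLaw PS W) with hadef
  have ha : ∀ s, PS s ≠ 0 → 0 < a s := fun s hs => tiltMean_outputLaw_pos hPS hK hf hs
  have hq := outputLaw_mem_stdSimplex hPS hK
  set r : S → ℝ := fun s => tiltWeight l dd (d s sh) / a s with hr
  have hr0 : ∀ s, PS s ≠ 0 → 0 ≤ r s := fun s hs =>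
    div_nonneg (tiltWeight_nonneg _ _ _) (ha s hs).le
  have key : ∀ ε : ℝ, 0 < ε → ε < 1 → ∑ s, PS s * ((r s - 1) / (1 + ε * (r s - 1))) ≤ 0 := by
    intro ε h0 h1
    have hpos : ∀ s, PS s ≠ 0 → 0 < 1 + ε * (r s - 1) := fun s hs => by
      have := mul_nonneg h0.le (hr0 s hs)
      linarith
    let Q : Sh → ℝ := fun sh' => (1 - ε) * outputLaw PS W sh' + ε * (Pi.single sh 1 : Sh → ℝ) sh'
    have hQ : Q ∈ stdSimplex ℝ Sh :=
      convex_stdSimplex ℝ Sh hq (single_mem_stdSimplex ℝ sh) (sub_pos.2 h1).le h0.le (by ring)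
    have hQa : ∀ s, PS s ≠ 0 → tiltMean d l dd Q s = a s * (1 + ε * (r s - 1)) := by
      intro s hs
      have e1 : tiltMean d l dd Q s = (1 - ε) * a s + ε * tiltWeight l dd (d s sh) := by
        simp only [tiltMean, Q, hadef, add_mul, Finset.sum_add_distrib, mul_assoc,
          ← Finset.mul_sum]
        simp [Pi.single_apply]
      have e2 : a s * r s = tiltWeight l dd (d s sh) := mul_div_cancel₀ _ (ha s hs).ne'
      rw [e1]
      linear_combination (-ε) * e2
    have h2 := hW.sum_log_tiltMean_le hPS hd hQ fun s hs => by
      rw [hQa s hs]; exact mul_pos (ha s hs) (hpos s hs)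
    have h3 : ∑ s, PS s * (ε * ((r s - 1) / (1 + ε * (r s - 1))))
        ≤ ∑ s, PS s * (Real.log (tiltMean d l dd Q s) - Real.log (a s)) := by
      refine Finset.sum_le_sum fun s _ => ?_
      by_cases hs : PS s = 0
      · simp [hs]
      refine mul_le_mul_of_nonneg_left ?_ (hPS.1 s)
      rw [hQa s hs, Real.log_mul (ha s hs).ne' (hpos s hs).ne', add_sub_cancel_left]
      refine le_trans (le_of_eq ?_) (Real.one_sub_inv_le_log_of_pos (hpos s hs))
      have := (hpos s hs).ne'
      field_simp
      ring
    simp only [mul_sub, Finset.sum_sub_distrib] at h3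
    have h4 : ε * ∑ s, PS s * ((r s - 1) / (1 + ε * (r s - 1))) ≤ 0 := by
      rw [Finset.mul_sum]
      simp only [mul_sub]
      refine le_trans (le_of_eq ?_) (h3.trans (sub_nonpos.2 h2))
      exact Finset.sum_congr rfl fun s _ => by ring
    exact nonpos_of_mul_nonpos_right h4 h0
  have hlim : Tendsto (fun ε : ℝ => ∑ s, PS s * ((r s - 1) / (1 + ε * (r s - 1)))) (𝓝[>] 0)
      (𝓝 (∑ s, PS s * ((r s - 1) / (1 + 0 * (r s - 1))))) := by
    refine tendsto_finsetSum _ fun s _ => Tendsto.const_mul _ ?_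
    refine (ContinuousAt.div continuousAt_const (by fun_prop) (by simp)).tendsto.mono_left
      nhdsWithin_le_nhds
  have h := le_of_tendsto hlim (by
    filter_upwards [Ioo_mem_nhdsGT (zero_lt_one (α := ℝ))] with ε hε using key ε hε.1 hε.2)
  simp only [zero_mul, add_zero, div_one] at h
  simp only [mul_sub, mul_one, Finset.sum_sub_distrib, hPS.2] at h
  linarith

/-- The defining property of the tilted information. -/
theorem TiltedSetting.sum_exp_tiltedInfo_le_one (hPS : PS ∈ stdSimplex ℝ S) (hdd : 0 ≤ dd)
    (hT : TiltedSetting PS d dd W) (sh : Sh) :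
    ∑ s, PS s * Real.exp (tiltedInfo PS d dd W s) * ind (d s sh ≤ ENNReal.ofReal dd) ≤ 1 := by
  classical
  rcases hT with ⟨hmin, hW, hd⟩ | ⟨rfl, hsub⟩
  -- `tiltedInfo` branches on `dd = 0`. Expected distortions are nonnegative, so `dMin ≥ 0` and `dd
  -- > dMin` selects the tilted branch.
  · have hne : dd ≠ 0 := by
      rintro rfl
      obtain ⟨_, ⟨D, hD, rfl⟩, hlt⟩ := sInf_lt_iff.1 hmin
      have hD : rateDistortion PS d D < ⊤ := hD
      obtain ⟨W', hW'⟩ : ∃ W', W' ∈ admissible PS d D := by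
        by_contra! hn
        refine hD.ne ?_
        simp [rateDistortion, hn]
      have h1 := (mem_admissible_iff hPS).1 hW'
      have h2 := realDistortion_nonneg (d := d) hPS h1.1
      have h3 : D < 0 := EReal.coe_lt_coe_iff.1 hlt
      linarith [h1.2.2]
    obtain ⟨hK, hf, -⟩ := (mem_admissible_iff hPS).1 hW.1
    refine le_trans (Finset.sum_le_sum fun s _ => ?_) (hW.sum_tiltWeight_div_le_one hPS hd sh)
    by_cases hs : PS s = 0
    · simp [hs]
    have ha := tiltMean_outputLaw_pos (l := lamStar PS d dd) (dd := dd) hPS hK hf hs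
    have : Real.exp (tiltedInfo PS d dd W s)
        = 1 / tiltMean d (lamStar PS d dd) dd (outputLaw PS W) s := by
      rw [tiltedInfo, if_neg hne]
      exact Real.exp_log (one_div_pos.2 ha)
    rw [this, mul_assoc, one_div_mul_eq_div]
    exact mul_le_mul_of_nonneg_left (div_le_div_of_nonneg_right
      (ind_le_tiltWeight (lamStar_nonneg hPS hW hd) hdd _) ha.le) (hPS.1 s)
  -- Each summand is now 0 or 1, and the hypothesis on `d` allows at most one 1.
  · have h1 : ∀ s, PS s * Real.exp (tiltedInfo PS d 0 W s) * ind (d s sh ≤ ENNReal.ofReal 0)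
        = if 0 < PS s ∧ d s sh = 0 then 1 else 0 := by
      intro s
      rw [tiltedInfo, if_pos rfl, ind]
      by_cases hs : PS s = 0
      · simp [hs]
      have hs' : 0 < PS s := (hPS.1 s).lt_of_ne (Ne.symm hs)
      rw [Real.exp_log (one_div_pos.2 hs')]
      simp [hs, hs']
    rw [Finset.sum_congr rfl fun s _ => h1 s, ← Finset.sum_filter, Finset.sum_const,
      nsmul_eq_mul, mul_one]
    have : (Finset.univ.filter fun s => 0 < PS s ∧ d s sh = 0).card ≤ 1 :=
      Finset.card_le_one.2 fun s hs s' hs' =>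
        hsub sh (Finset.mem_filter.1 hs).2 (Finset.mem_filter.1 hs').2
    exact_mod_cast this

end Tilted

/-! ### The explicit dual point -/

theorem IsKernel.le_one {α β : Type*} [Fintype β] {k : α → β → ℝ} (hk : IsKernel k) (a : α)
    (b : β) : k a b ≤ 1 := by
  rw [← hk.sum_eq_one a]
  exact Finset.single_le_sum (fun b _ => hk.nonneg a b) (Finset.mem_univ b)

theorem ind_nonneg (p : Prop) : 0 ≤ ind p := by
  rw [ind]; split_ifs
  exacts [zero_le_one, le_rfl]

theorem ind_of_true {p : Prop} (h : p) : ind p = 1 := if_pos h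

theorem ind_of_false {p : Prop} (h : ¬p) : ind p = 0 := if_neg h

section Bounds

variable {S X Y Sh : Type*} [Fintype Y] {PYX : X → Y → ℝ} {T : ℕ}

/-- Reconciles the extended-valued event with the real comparison in the dual point. In the
ambiguous case `0 / 0` the quotient is 0, the density is `-∞`, and both sides hold. -/
theorem le_sub_infoDensity_iff (A : Auxiliary PYX T) (j γ : ℝ) (x : X) (y : Y) (t : Fin T) :
    (γ : EReal) ≤ (j : EReal) - infoDensity A x y t ↔
      A.PYXV x t y ≤ A.Pbar t y * Real.exp (j - γ) := by
  rw [infoDensity]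
  rcases ((A.isKernel_PYXV x).nonneg t y).eq_or_lt with hu | hu
  · rw [← hu, ENNReal.ofReal_zero, ENNReal.zero_div, ENNReal.log_zero, EReal.coe_sub_bot]
    exact iff_of_true le_top (mul_nonneg (A.isKernel_Pbar.nonneg t y) (Real.exp_pos _).le)
  rcases (A.isKernel_Pbar.nonneg t y).eq_or_lt with hv | hv
  · rw [← hv, ENNReal.ofReal_zero, ENNReal.div_zero (ENNReal.ofReal_pos.2 hu).ne',
      ENNReal.log_top, sub_eq_add_neg, EReal.neg_top, EReal.add_bot, zero_mul]
    exact iff_of_false (not_le.2 (EReal.bot_lt_coe γ)) (not_le.2 hu)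
  · rw [← ENNReal.ofReal_div_of_pos hv, ENNReal.log_ofReal_of_pos (div_pos hu hv),
      ← EReal.coe_sub, EReal.coe_le_coe_iff, le_sub_comm, Real.log_le_iff_le_exp (div_pos hu hv),
      div_le_iff₀ hv, mul_comm]

theorem sum_dualLamB (PS : S → ℝ) (j : S → ℝ) (A : Auxiliary PYX T) (γ : ℝ) (x : X) (s : S) :
    ∑ y, dualLamB PS j A γ x s y = PS s * (probGe A (j s) γ x + extraTerm A (j s) γ x) := by
  simp only [dualLamB, probGe, extraTerm, ← Finset.mul_sum, Finset.sum_add_distrib, ← not_le,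
    le_sub_infoDensity_iff]
  congr 2
  · exact Finset.sum_congr rfl fun y _ => Finset.sum_congr rfl fun t _ => by ring
  · simp only [Finset.mul_sum]
    exact Finset.sum_congr rfl fun y _ => Finset.sum_congr rfl fun t _ => by ring

theorem extraTerm_nonneg (A : Auxiliary PYX T) (j γ : ℝ) (x : X) : 0 ≤ extraTerm A j γ x :=
  mul_nonneg (Real.exp_pos _).le <| Finset.sum_nonneg fun y _ => Finset.sum_nonneg fun t _ =>
    mul_nonneg (mul_nonneg (A.isKernel_PVX.nonneg x t) (A.isKernel_Pbar.nonneg t y)) (ind_nonneg _)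

/-- `dualLamB` as a minimum. -/
theorem dualLamB_eq_sum_min (PS : S → ℝ) (j : S → ℝ) (A : Auxiliary PYX T) (γ : ℝ) (x : X) (s : S)
    (y : Y) : dualLamB PS j A γ x s y
      = PS s * ∑ t, min (A.PYXV x t y) (A.Pbar t y * Real.exp (j s - γ)) * A.PVX x t := by
  rw [dualLamB]
  congr 1
  refine Finset.sum_congr rfl fun t _ => ?_
  rcases le_or_gt (A.PYXV x t y) (A.Pbar t y * Real.exp (j s - γ)) with h | h
  · rw [ind_of_true h, ind_of_false (not_lt.2 h), min_eq_left h]; ring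
  · rw [ind_of_false (not_le.2 h), ind_of_true h, min_eq_right h.le]; ring

theorem dualLamB_le_channel {PS : S → ℝ} {s : S} (hs : 0 ≤ PS s) (j : S → ℝ)
    (A : Auxiliary PYX T) (γ : ℝ) (x : X) (y : Y) :
    dualLamB PS j A γ x s y ≤ PS s * PYX x y := by
  rw [dualLamB_eq_sum_min, A.channel_eq]
  exact mul_le_mul_of_nonneg_left (Finset.sum_le_sum fun t _ =>
    mul_le_mul_of_nonneg_right (min_le_left _ _) (A.isKernel_PVX.nonneg x t)) hs

/-- Uses the second argument of the minimum and discards `P_{V|X} ≤ 1`; this is why `∑ t, A.Pbar t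
y` appears in `lamA` and, eventually, the factor `T` in the bounds. -/
theorem dualLamB_le_Pbar {PS : S → ℝ} {s : S} (hs : 0 ≤ PS s) (j : S → ℝ)
    (A : Auxiliary PYX T) (γ : ℝ) (x : X) (y : Y) :
    dualLamB PS j A γ x s y ≤ PS s * Real.exp (j s - γ) * ∑ t, A.Pbar t y := by
  rw [dualLamB_eq_sum_min, mul_assoc]
  refine mul_le_mul_of_nonneg_left ?_ hs
  rw [Finset.mul_sum]
  refine Finset.sum_le_sum fun t _ => ?_
  have h0 : 0 ≤ A.Pbar t y * Real.exp (j s - γ) :=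
    mul_nonneg (A.isKernel_Pbar.nonneg t y) (Real.exp_pos _).le
  refine (mul_le_mul_of_nonneg_right (min_le_right _ _) (A.isKernel_PVX.nonneg x t)).trans ?_
  refine (mul_le_of_le_one_right h0 (A.isKernel_PVX.le_one x t)).trans (le_of_eq (mul_comm _ _))

variable [Fintype S] [Fintype X] [Fintype Sh]

theorem dualPoint_feasible {PS : S → ℝ} (hPS : PS ∈ stdSimplex ℝ S) (d : S → Sh → ℝ≥0∞)
    (dd : ℝ) {j : S → ℝ}
    (hj : ∀ sh, ∑ s, PS s * Real.exp (j s) * ind (d s sh ≤ ENNReal.ofReal dd) ≤ 1)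
    (A : Auxiliary PYX T) (γ : ℝ) :
    (dualPoint PS d dd j A γ).Feasible PS PYX (excessLoss d dd) where
  D1 x s := by
    simp only [dualPoint, Finset.sum_const_zero, sub_zero, sub_nonpos]
    exact ciInf_le (Set.finite_range _).bddBelow x
  D2 sh y := by
    simp only [dualPoint, Finset.sum_const_zero, sub_zero, Finset.sum_neg_distrib, sub_neg_eq_add]
    have h0 : 0 ≤ Real.exp (-γ) * ∑ t, A.Pbar t y := mul_nonneg (Real.exp_pos _).le
      (Finset.sum_nonneg fun t _ => A.isKernel_Pbar.nonneg t y)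
    have e : ∑ s, PS s * Real.exp (j s - γ) * ind (d s sh ≤ ENNReal.ofReal dd) * ∑ t, A.Pbar t y
        = (∑ s, PS s * Real.exp (j s) * ind (d s sh ≤ ENNReal.ofReal dd))
          * (Real.exp (-γ) * ∑ t, A.Pbar t y) := by
      rw [Finset.sum_mul]
      refine Finset.sum_congr rfl fun s _ => ?_
      rw [sub_eq_add_neg, Real.exp_add]
      ring
    rw [e]
    have := mul_le_mul_of_nonneg_right (hj sh) h0
    linarith
  D3 s x y sh := by
    simp only [dualPoint, excessLoss, add_zero]
    rcases le_or_gt (d s sh) (ENNReal.ofReal dd) with h | h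
    · rw [ind_of_true h, ind_of_false (not_lt.2 h)]
      have := dualLamB_le_Pbar (hPS.1 s) j A γ x y
      linarith
    · rw [ind_of_false (not_le.2 h), ind_of_true h]
      have := dualLamB_le_channel (hPS.1 s) j A γ x y
      linarith
  mu_nonneg _ _ _ _ := le_rfl

theorem dualPoint_objective {PS : S → ℝ} (hPS : PS ∈ stdSimplex ℝ S) (d : S → Sh → ℝ≥0∞)
    (dd : ℝ) (j : S → ℝ) (A : Auxiliary PYX T) (γ : ℝ) :
    (dualPoint PS d dd j A γ).objective = improvedValue PS j A γ := by
  simp only [DPPoint.objective, dualPoint, Finset.sum_const_zero, sub_zero, sum_dualLamB,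
    improvedValue, ← Finset.mul_sum]
  rw [Finset.sum_comm]
  simp only [A.isKernel_Pbar.sum_eq_one, Finset.sum_const, Finset.card_univ, Fintype.card_fin,
    -- `gammaA` has `PS s` inside the infimum, `improvedValue` outside.
    nsmul_eq_mul, mul_one, Real.mul_iInf_of_nonneg (hPS.1 _)]
  ring

theorem kvValue_le_improvedValue {PS : S → ℝ} (hPS : PS ∈ stdSimplex ℝ S) (j : S → ℝ)
    (A : Auxiliary PYX T) (γ : ℝ) : kvValue PS j A γ ≤ improvedValue PS j A γ :=
  sub_le_sub_right (Finset.sum_le_sum fun s _ => mul_le_mul_of_nonneg_left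
    (ciInf_mono (Set.finite_range _).bddBelow fun x =>
      le_add_of_nonneg_right (extraTerm_nonneg A (j s) γ x)) (hPS.1 s)) _

theorem kvBound_le_improvedBound {PS : S → ℝ} (hPS : PS ∈ stdSimplex ℝ S) (j : S → ℝ) :
    kvBound PS PYX j ≤ improvedBound PS PYX j :=
  iSup_mono fun γ => iSup_le fun _ => iSup_mono fun _ => iSup_mono fun _ => iSup_mono fun A =>
    EReal.coe_le_coe_iff.2 (kvValue_le_improvedValue hPS j A γ)

/-! ### Codes -/

variable {PS : S → ℝ} {κ : S → X → Y → Sh → ℝ}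

theorem optSC_le_excessProb (PS : S → ℝ) (PYX : X → Y → ℝ) (d : S → Sh → ℝ≥0∞) (dd : ℝ)
    (f : S → X) (g : Y → Sh) :
    optSC PS PYX (excessLoss d dd) ≤ ((excessProb PS PYX d dd f g : ℝ) : EReal) := by
  classical
  let a : S → X → ℝ := fun s => Pi.single (f s) 1
  let b : Y → Sh → ℝ := fun y => Pi.single (g y) 1
  let p : SCPoint S X Y Sh := ⟨fun s x y sh => PS s * a s x * PYX x y * b y sh, a, b⟩
  have hp : p.Feasible PS PYX := ⟨fun _ _ _ _ => rfl, fun s => single_mem_stdSimplex ℝ (f s),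
    fun y => single_mem_stdSimplex ℝ (g y)⟩
  refine iInf₂_le_of_le p hp (le_of_eq (congrArg _ ?_))
  simp only [SCPoint.objective, excessProb, p, a, b, excessLoss, Pi.single_apply]
  refine Finset.sum_congr rfl fun s _ => ?_
  rw [Finset.sum_comm]
  refine Finset.sum_congr rfl fun y _ => ?_
  simp [mul_comm]

/-- The point of LP induced by a randomized code. -/
theorem SCPoint.Feasible.toLP {S X Y Sh : Type*} [Fintype X] [Fintype Sh] {PS : S → ℝ}
    {PYX : X → Y → ℝ} {p : SCPoint S X Y Sh} (hp : p.Feasible PS PYX) :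
    LPPoint.Feasible (X := X) (S := S)
      ⟨p.QXS, p.QShY, fun s x y sh => p.QXS s x * p.QShY y sh⟩ := by
  obtain ⟨-, hX, hSh⟩ := hp
  exact
    { sum_QXS := hX.sum_eq_one
      sum_QShY := hSh.sum_eq_one
      sum_W_x := fun s sh y => by simp only [← Finset.sum_mul, hX.sum_eq_one, one_mul, sub_self]
      sum_W_sh := fun x s y => by simp only [← Finset.mul_sum, hSh.sum_eq_one, mul_one, sub_self]
      mccormick := fun s x y sh => by
        -- McCormick's inequality is `0 ≤ (1 - Q_{X|S}) (1 - Q_{Ŝ|Y})`, expanded.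
        have := mul_nonneg (sub_nonneg.2 (hX.le_one s x)) (sub_nonneg.2 (hSh.le_one y sh))
        linarith
      QXS_nonneg := hX.nonneg
      QShY_nonneg := hSh.nonneg
      W_nonneg := fun s x y sh => mul_nonneg (hX.nonneg s x) (hSh.nonneg y sh) }

theorem optLP_le_optSC (PS : S → ℝ) (PYX : X → Y → ℝ) (κ : S → X → Y → Sh → ℝ) :
    optLP PS PYX κ ≤ optSC PS PYX κ := by
  refine le_iInf₂ fun p hp => iInf₂_le_of_le _ hp.toLP (le_of_eq (congrArg _ ?_))
  simp only [LPPoint.objective, SCPoint.objective, hp.1]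
  exact Finset.sum_congr rfl fun s _ => Finset.sum_congr rfl fun x _ =>
    Finset.sum_congr rfl fun y _ => Finset.sum_congr rfl fun sh _ => by ring

theorem exists_SCPoint_feasible {S X Y Sh : Type*} [Fintype X] [Fintype Sh] [Nonempty X]
    [Nonempty Sh] (PS : S → ℝ) (PYX : X → Y → ℝ) :
    ∃ p : SCPoint S X Y Sh, p.Feasible PS PYX := by
  classical
  let a : S → X → ℝ := fun _ => Pi.single (Classical.arbitrary X) 1
  let b : Y → Sh → ℝ := fun _ => Pi.single (Classical.arbitrary Sh) 1
  exact ⟨⟨fun s x y sh => PS s * a s x * PYX x y * b y sh, a, b⟩, fun _ _ _ _ => rfl,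
    fun _ => single_mem_stdSimplex ℝ _, fun _ => single_mem_stdSimplex ℝ _⟩

/-- **Strong duality** for LP and DP, with attainment in DP. -/
theorem exists_dual_optimum [Nonempty X] [Nonempty Sh]
    (h0 : ∀ s x y sh, 0 ≤ κ s x y sh * PS s * PYX x y) :
    ∃ q : DPPoint S X Y Sh, q.Feasible PS PYX κ ∧ optLP PS PYX κ ≤ ((q.objective : ℝ) : EReal) := by
  -- Nonnegative costs and the existence of a code make the optimum a real number, so it can serve
  -- as the level `v` in `exists_dual_feasible_ge`.
  have hnn : 0 ≤ optLP PS PYX κ := le_iInf₂ fun p hp => EReal.coe_nonneg.2 <|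
    Finset.sum_nonneg fun s _ => Finset.sum_nonneg fun x _ => Finset.sum_nonneg fun y _ =>
      Finset.sum_nonneg fun sh _ => mul_nonneg (h0 s x y sh) (hp.W_nonneg s x y sh)
  obtain ⟨p, hp⟩ := exists_SCPoint_feasible (Sh := Sh) PS PYX
  have hle : optLP PS PYX κ ≤ (_ : EReal) := iInf₂_le _ hp.toLP
  have hv : ((optLP PS PYX κ).toReal : EReal) = optLP PS PYX κ :=
    EReal.coe_toReal (ne_top_of_le_ne_top (EReal.coe_ne_top _) hle)
      (ne_bot_of_le_ne_bot EReal.zero_ne_bot hnn)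
  obtain ⟨q, hq, hqv⟩ := exists_dual_feasible_ge (PS := PS) (PYX := PYX) (κ := κ)
    (optLP PS PYX κ).toReal fun p hp => by
      rw [← EReal.coe_le_coe_iff, hv]
      exact iInf₂_le p hp
  exact ⟨q, hq, by rw [← hv]; exact EReal.coe_le_coe_iff.2 hqv⟩

end Bounds

end JSCC

end

/-! ### The chain of converse bounds -/

theorem mainTheorem1
    {S X Y Sh : Type*} [Fintype S] [Fintype X] [Fintype Y] [Fintype Sh]
    [Nonempty X] [Nonempty Sh]
    (PS : S → ℝ) (hPS : PS ∈ stdSimplex ℝ S)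
    (PYX : X → Y → ℝ) (hPYX : JSCC.IsKernel PYX)
    (d : S → Sh → ENNReal) (dd : ℝ) (hdd : 0 ≤ dd)
    (Wstar : S → Sh → ℝ) (hT : JSCC.TiltedSetting PS d dd Wstar)
    (κ : S → X → Y → Sh → ℝ) (hκ : κ = JSCC.excessLoss d dd)
    (j : S → ℝ) (hj : j = JSCC.tiltedInfo PS d dd Wstar) :
    -- for all parameters, the explicit point is feasible for DP, its objective is the improved
    -- expression, and the latter exceeds the Kostina-Verdú expression by a nonnegative term
    (∀ (γ : ℝ) (T : ℕ), 0 < T → ∀ A : JSCC.Auxiliary PYX T,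
      (JSCC.dualPoint PS d dd j A γ).Feasible PS PYX κ ∧
      (JSCC.dualPoint PS d dd j A γ).objective = JSCC.improvedValue PS j A γ ∧
      (∀ s x, 0 ≤ JSCC.extraTerm A (j s) γ x) ∧
      JSCC.kvValue PS j A γ ≤ JSCC.improvedValue PS j A γ) ∧
    -- the chain of lower bounds on the excess distortion probability of any code
    (∀ (f : S → X) (g : Y → Sh),
      JSCC.optSC PS PYX κ ≤ ((JSCC.excessProb PS PYX d dd f g : ℝ) : EReal)) ∧
    (∀ p : JSCC.SCPoint S X Y Sh, p.Feasible PS PYX →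
      JSCC.optSC PS PYX κ ≤ ((p.objective κ : ℝ) : EReal)) ∧
    JSCC.optLP PS PYX κ ≤ JSCC.optSC PS PYX κ ∧
    JSCC.optLP PS PYX κ = JSCC.optDP PS PYX κ ∧
    JSCC.improvedBound PS PYX j ≤ JSCC.optDP PS PYX κ ∧
    JSCC.kvBound PS PYX j ≤ JSCC.improvedBound PS PYX j ∧
    -- a single feasible point of DP is at least as good as both converses
    (∃ p : JSCC.DPPoint S X Y Sh, p.Feasible PS PYX κ ∧
      JSCC.improvedBound PS PYX j ≤ ((p.objective : ℝ) : EReal)) := by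
  subst hκ hj
  have hfeas : ∀ (γ : ℝ) (T : ℕ) (A : JSCC.Auxiliary PYX T),
      (JSCC.dualPoint PS d dd (JSCC.tiltedInfo PS d dd Wstar) A γ).Feasible PS PYX
        (JSCC.excessLoss d dd) := fun γ T A =>
    JSCC.dualPoint_feasible hPS d dd (hT.sum_exp_tiltedInfo_le_one hPS hdd) A γ
  have hobj := fun (γ : ℝ) (T : ℕ) (A : JSCC.Auxiliary PYX T) =>
    JSCC.dualPoint_objective hPS d dd (JSCC.tiltedInfo PS d dd Wstar) A γ
  obtain ⟨q, hq, hqopt⟩ := JSCC.exists_dual_optimum (PS := PS) (PYX := PYX)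
    (κ := JSCC.excessLoss d dd) fun s x y sh =>
      mul_nonneg (mul_nonneg (JSCC.ind_nonneg _) (hPS.1 s)) (hPYX.nonneg x y)
  have himp : JSCC.improvedBound PS PYX (JSCC.tiltedInfo PS d dd Wstar)
      ≤ JSCC.optDP PS PYX (JSCC.excessLoss d dd) :=
    iSup_le fun γ => iSup_le fun T => iSup_le fun _ => iSup_le fun A => by
      rw [← hobj γ T A]
      exact le_iSup₂_of_le _ (hfeas γ T A) le_rfl
  exact ⟨fun γ T _ A => ⟨hfeas γ T A, hobj γ T A,
      fun s x => JSCC.extraTerm_nonneg A _ γ x, JSCC.kvValue_le_improvedValue hPS _ A γ⟩,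
    fun f g => JSCC.optSC_le_excessProb PS PYX d dd f g,
    fun p hp => iInf₂_le p hp,
    JSCC.optLP_le_optSC PS PYX _,
    le_antisymm (hqopt.trans (le_iSup₂_of_le q hq le_rfl)) JSCC.optDP_le_optLP,
    himp,
    JSCC.kvBound_le_improvedBound hPS _,
    q, hq, himp.trans (JSCC.optDP_le_optLP.trans hqopt)⟩
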